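/- **Setting.** Let $\mathcal D$ be a set of datasets with a neighbouring relation. A query $q:\mathcal D\to\mathbb R$ has sensitivity at most one if $|q(X)-q(X')|\le 1$ for all neighbouring $X,X'$. A randomized algorithm $\mathcal A$ on $\mathcal D$ is $(\varepsilon,\delta)$-differentially private (DP) if $\Pr[\mathcal A(X)\in S]\le e^{\varepsilon}\Pr[\mathcal A(X')\in S]+\delta$ for all neighbouring $X,X'$ and all measurable sets $S$ of outputs. $\mathrm{Lap}(b)$ is the Laplace distribution on $\mathbb R$ with density $\frac1{2b}e^{-|x|/b}$, and $\log$ is the natural logarithm. **Subroutine** $\mathrm{PermutedAboveThreshold}^{\eta}_{T}(f_1,\dots,f_k)$, for values $f_i\in\mathbb R\cup\{\infty\}$: draw a uniformly random permutation $\pi$ of $\{1,\dots,k\}$ and, independently, $\rho\sim\mathrm{Lap}(2/\eta)$ and $\nu_1,\dots,\nu_k\sim\mathrm{Lap}(4/\eta)$. Let $i$ be the least index with $f_{\pi(i)}+\nu_i\ge T+\rho$ and return $\pi(i)$; if there is no such $i$, return nothing. **Algorithm.** Given $k\in\mathbb N$, $\varepsilon\in(0,1]$, $\delta\in(0,0.5]$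 and queries $q_1,\dots,q_k$ on a dataset $X$, put $\kappa=0.9$, $\lambda=0.95$, $L=\lceil 10\log_{1/\kappa}\log k\rceil$ (read as $0$ if this is negative or undefined), $\varepsilon_0=\frac{\varepsilon}{1000\sqrt{\log(1/\delta)}}$ and, for $\ell\ge1$, $$m_\ell=\kappa^\ell k,\qquad \varepsilon_\ell=\frac{\varepsilon_0}{\sqrt k}\cdot\frac1{\sqrt{\ell\lambda^\ell}},\qquad w_\ell=\frac{100\log(500k/m_\ell)}{\varepsilon_\ell},\qquad T_\ell=4(w_1+\dots+w_{\ell-1})+3w_\ell+2w_{\ell+1}.$$ Start with $(a_1,\dots,a_k)=(\infty,\dots,\infty)$. For $\ell=1,\dots,L$, repeat $\lfloor m_\ell\rfloor$ times, with fresh independent randomness: run $\mathrm{PermutedAboveThreshold}^{0.5\varepsilon_\ell}_{T_\ell}(|q_1(X)-a_1|,\dots,|q_k(X)-a_k|)$; if it returns an index $i^*$, replace $a_{i^*}$ by $q_{i^*}(X)+Z$ with $Z\sim\mathrm{Lap}(2/\varepsilon_\ell)$. Output $(a_1,\dots,a_k)$. **Theorem.** There are absolute constants $C_1,C_2,c>0$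 such that, for every set of datasets with a neighbouring relation, every $k\in\mathbb N$, $\varepsilon\in(0,1]$, $\delta\in(0,0.5]$ and all queries $q_1,\dots,q_k$ of sensitivity at most one: 1. (Privacy) the algorithm is $(\varepsilon,\delta)$-DP; 2. (Utility) if $k\ge2$ then, for every dataset $X$, with probability at least $1-2^{-c\,k/(\log k)^{10}}$ the output satisfies $$\Bigl|\Bigl\{i\in\{1,\dots,k\} : |q_i(X)-a_i|>\frac{C_1}{\varepsilon}\sqrt{k\log\tfrac1\delta}\Bigr\}\Bigr|\le \frac{C_2\,k}{(\log k)^{10}}.$$ -/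

import Mathlib

open MeasureTheory
open scoped ENNReal

noncomputable section

namespace ISV

/-! ### Differential privacy -/

/-- A real-valued query `f` has sensitivity at most one with respect to the
neighbouring relation `Nbr` on datasets. -/
def SensitivityLeOne {D : Type*} (Nbr : D → D → Prop) (f : D → ℝ) : Prop :=
  ∀ X X' : D, Nbr X X' → |f X - f X'| ≤ 1

/-- A randomized algorithm `A`, given by its output distribution `A X` on every dataset `X`, is
`(ε, δ)`-differentially private with respect to the neighbouring relation `Nbr`. -/
def IsDP {D O : Type*} [MeasurableSpace O] (Nbr : D → D → Prop) (ε δ : ℝ)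
    (A : D → Measure O) : Prop :=
  ∀ X X' : D, Nbr X X' → ∀ S : Set O, MeasurableSet S →
    A X S ≤ ENNReal.ofReal (Real.exp ε) * A X' S + ENNReal.ofReal δ

/-- The target error bound `(1 / ε) * √(k * log (1 / δ))`. -/
def errBound (k : ℕ) (ε δ : ℝ) : ℝ := 1 / ε * Real.sqrt (k * Real.log (1 / δ))

/-! ### The algorithms -/

/-- The Laplace distribution `Lap(b)`: centred at `0`, with density `exp (-|x| / b) / (2 * b)`. -/
def lap (b : ℝ) : Measure ℝ :=
  volume.withDensity fun x => ENNReal.ofReal (Real.exp (-|x| / b) / (2 * b))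

instance instMeasurableSpaceOptionFin (k : ℕ) : MeasurableSpace (Option (Fin k)) := ⊤

/-- The first index `i` with `g i + ν i ≥ T + ρ`, or `none` if there is no such index.
The values `g i` may be `∞`. -/
def firstAbove {k : ℕ} (T : ℝ) (g : Fin k → WithTop ℝ) (ρ : ℝ) (ν : Fin k → ℝ) :
    Option (Fin k) :=
  open Classical in
  Fin.find? fun i => decide (((T + ρ : ℝ) : WithTop ℝ) ≤ g i + ((ν i : ℝ) : WithTop ℝ))

/-- AboveThreshold with privacy parameter `ε` and threshold `T`, run on the values
`g 0, …, g (k - 1)` of the queries: draw `ρ ∼ Lap(2 / ε)` and independent `ν i ∼ Lap(4 / ε)`, and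
return the first index `i` with `g i + ν i ≥ T + ρ` (`none` if the loop ends without returning). -/
def aboveThreshold {k : ℕ} (ε T : ℝ) (g : Fin k → WithTop ℝ) : Measure (Option (Fin k)) :=
  ((lap (2 / ε)).prod (Measure.pi fun _ : Fin k => lap (4 / ε))).map
    fun n => firstAbove T g n.1 n.2

/-- Permuted AboveThreshold: draw a uniformly random permutation `π`, run AboveThreshold on
`f (π 0), …, f (π (k - 1))`, and return the original index `π i` of the query at the position `i`
that was returned. -/
def permutedAboveThreshold {k : ℕ} (ε T : ℝ) (f : Fin k → WithTop ℝ) :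
    Measure (Option (Fin k)) :=
  ((k.factorial : ℝ≥0∞))⁻¹ •
    ∑ π : Equiv.Perm (Fin k), (aboveThreshold ε T fun i => f (π i)).map (Option.map π)

/-- The error `|v - a|` of an answer `a`, which may be `∞`, to a query with true value `v`. -/
def absErr (v : ℝ) (a : WithTop ℝ) : WithTop ℝ := a.map fun x => |v - x|

/-- One correction: select an index `i` by permuted AboveThreshold (privacy parameter `ε / 2`,
threshold `T`) run on the current errors, and replace the answer `a i` by
`v i + Lap(2 / ε)`. If no index is selected then the answers stay as they are. -/
def correction {k : ℕ} (v : Fin k → ℝ) (ε T : ℝ) (a : Fin k → WithTop ℝ) :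
    Measure (Fin k → WithTop ℝ) :=
  (permutedAboveThreshold (0.5 * ε) T fun i => absErr (v i) (a i)).bind fun o =>
    match o with
    | none => Measure.dirac a
    | some i => (lap (2 / ε)).map fun z => Function.update a i ((v i + z : ℝ) : WithTop ℝ)

/-- Iterative sparse vector correction on the true values `v` of the queries: start from the
answers `(∞, …, ∞)` and, in the stages `l = 1, …, L`, do `m l` corrections, each with privacy
parameter `ε l` and threshold `T l`. The value is the distribution of the answers. -/
def iterativeSV {k : ℕ} (v : Fin k → ℝ) (ε : ℕ → ℝ) (m : ℕ → ℕ) (T : ℕ → ℝ) :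
    ℕ → Measure (Fin k → WithTop ℝ)
  | 0 => Measure.dirac fun _ => ⊤
  | l + 1 => (fun μ => μ.bind (correction v (ε (l + 1)) (T (l + 1))))^[m (l + 1)]
      (iterativeSV v ε m T l)

/-! ### The parameters -/

/-- `κ = 0.9`. -/
def kappa : ℝ := 0.9

/-- `λ = 0.95`. -/
def lam : ℝ := 0.95

/-- `L = ⌈10 log_{1/κ} log k⌉`, read as `0` where this is not a positive number. -/
def numStages (k : ℕ) : ℕ := ⌈10 * Real.logb (1 / kappa) (Real.log k)⌉₊

/-- `ε₀ = ε / (1000 √(log (1 / δ)))`. -/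
def epsZero (ε δ : ℝ) : ℝ := ε / (1000 * Real.sqrt (Real.log (1 / δ)))

/-- `m_l = κ ^ l * k`. -/
def mReal (k l : ℕ) : ℝ := kappa ^ l * k

/-- The number of corrections in stage `l`. It is `m_l` whenever `m_l` is an integer. -/
def mCount (k l : ℕ) : ℕ := ⌊mReal k l⌋₊

/-- `ε_l = (ε₀ / √k) * (1 / √(l * λ ^ l))`. -/
def epsStage (k : ℕ) (ε δ : ℝ) (l : ℕ) : ℝ :=
  epsZero ε δ / Real.sqrt k * (1 / Real.sqrt (l * lam ^ l))

/-- `w_l = 100 log (500 k / m_l) / ε_l`. -/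
def width (k : ℕ) (ε δ : ℝ) (l : ℕ) : ℝ :=
  100 * Real.log (500 * k / mReal k l) / epsStage k ε δ l

/-- `T_l = 4 (w_1 + ⋯ + w_{l-1}) + 3 w_l + 2 w_{l+1}`. -/
def threshold (k : ℕ) (ε δ : ℝ) (l : ℕ) : ℝ :=
  4 * (∑ j ∈ Finset.Ico 1 l, width k ε δ j) + 3 * width k ε δ l + 2 * width k ε δ (l + 1)

/-- The iterative sparse vector correction algorithm, with the parameters above, on the queries
`q` and the dataset `X`. -/
def algorithm {D : Type*} {k : ℕ} (ε δ : ℝ) (q : Fin k → D → ℝ) (X : D) :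
    Measure (Fin k → WithTop ℝ) :=
  iterativeSV (fun i => q i X) (epsStage k ε δ) (mCount k) (threshold k ε δ) (numStages k)

end ISV

end

noncomputable section

namespace ISV

/-! ### Product measures -/

/-! Privacy. Raising the threshold noise by 1 and the noise of the selected query by 2 turns a run
of the selection on one dataset into a run on a neighbour with the same outcome. Together with the
noisy answer this makes a correction purely `ε_l`-private (`correction_le`). Pure privacy in both
directions bounds the Rényi divergence of order `α` by `α ε_l²`. This is used in the dual form
`HolderBound`, whose constants multiply along adaptive steps (`HolderBound.bind`). Since `m_l ε_l² ≤
ε₀² (κ/λ)^l` with `κ < λ`, the total is `O(ε₀²)` for any number of stages, and `le_of_holderBound`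
turns it into `(ε, δ)`-privacy.

Utility. The invariant is that after stage `l` at most `κ^l k` answers have error above `radius l`.
In stage `l + 1` put `m = κ^l k`, let `B` count the errors above the new radius and `N` those above
the old one, so `B ≤ N`. While `B > m/2`, a random order probably meets a query counted by `B` among
its first `O(k/m)` positions. Only that many noises have to be small, which is why the widths carry
`log (k/m_l)` and not `log k`. The selected index is then counted by `N` and its new answer is
probably accurate, so `exp N` shrinks in mean by a constant factor. Once `B ≤ m/2`, only rare
inaccurate answers can raise it. As about `0.9 m` steps are more than enough to bring `N` below
`m/2`, the stage fails with probability exponentially small in `m` (`hitProb_le_of_two_drifts`,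
`stage_failure_le`).

The last stages, where `m` is about `k / (log k)^10`, dominate the union bound. The widths are
`errBound` times a summable sequence, because `λ < 1`, so all radii are within a constant of
`errBound` (`radius_le_errBound`). -/

theorem pi_measure_mono {ι : Type*} [Fintype ι] {α : ι → Type*} [∀ i, MeasurableSpace (α i)]
    {μ ν : ∀ i, Measure (α i)} [∀ i, SigmaFinite (μ i)] (h : ∀ i, μ i ≤ ν i) :
    Measure.pi μ ≤ Measure.pi ν := by
  refine Measure.le_iff.2 fun A hA => ?_
  -- `OuterMeasure.pi` is the largest outer measure bounded by the product on boxes, so comparing on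
  -- boxes is enough.
  have h1 : (Measure.pi μ).toOuterMeasure ≤ OuterMeasure.pi fun i => (ν i).toOuterMeasure := by
    rw [OuterMeasure.le_pi]
    intro s _
    calc (Measure.pi μ) (Set.pi Set.univ s) = ∏ i, μ i (s i) := Measure.pi_pi μ s
      _ ≤ ∏ i, ν i (s i) := Finset.prod_le_prod' fun i _ => h i (s i)
  rw [Measure.pi_def ν]
  exact (h1 A).trans (le_toMeasure_apply _ _ _)

theorem pi_measure_smul {ι : Type*} [Fintype ι] {α : ι → Type*} [∀ i, MeasurableSpace (α i)]
    (ν : ∀ i, Measure (α i)) [∀ i, IsFiniteMeasure (ν i)] {c : ι → ℝ≥0∞} (hc : ∀ i, c i ≠ ∞) :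
    Measure.pi (fun i => c i • ν i) = (∏ i, c i) • Measure.pi ν := by
  have : ∀ i, IsFiniteMeasure (c i • ν i) := fun i => Measure.smul_finite _ (hc i)
  refine Measure.pi_eq fun s _ => ?_
  simp [Measure.pi_pi, Finset.prod_mul_distrib]

/-! ### The Laplace distribution -/

theorem measurable_lapDensity (b : ℝ) :
    Measurable fun x : ℝ => ENNReal.ofReal (Real.exp (-|x| / b) / (2 * b)) := by
  fun_prop

theorem isProbabilityMeasure_lap {b : ℝ} (hb : 0 < b) : IsProbabilityMeasure (lap b) := by
  constructor
  have hint : ∫ x : ℝ, Real.exp (-|x| / b) / (2 * b) = 1 := by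
    have h := integral_exp_mul_Ioi (a := -b⁻¹) (by simpa using hb) 0
    rw [integral_comp_abs (f := fun x : ℝ => Real.exp (-x / b) / (2 * b)), integral_div,
      show (fun x : ℝ => Real.exp (-x / b)) = fun x => Real.exp (-b⁻¹ * x) by
        ext x; congr 1; ring, h]
    simp
    field_simp
  rw [lap, withDensity_apply _ MeasurableSet.univ, setLIntegral_univ,
    ← ofReal_integral_eq_lintegral_ofReal
      (by by_contra h; rw [integral_undef h] at hint; norm_num at hint)
      (Filter.Eventually.of_forall fun x => by positivity), hint]
  simp

instance instSigmaFiniteLap (b : ℝ) : SigmaFinite (lap b) := by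
  unfold lap; infer_instance

/-- By the triangle inequality the densities at `x - c` and at `x` differ by a factor of at most
`exp (|c| / b)`. -/
theorem lap_map_add_le {b : ℝ} (hb : 0 < b) (c : ℝ) :
    (lap b).map (fun x => x + c) ≤ ENNReal.ofReal (Real.exp (|c| / b)) • lap b := by
  refine Measure.le_iff.2 fun S hS => ?_
  have hm : Measurable fun x : ℝ => x + c := by fun_prop
  rw [Measure.map_apply hm hS, Measure.smul_apply, smul_eq_mul, lap,
    withDensity_apply _ (hm hS), withDensity_apply _ hS, ← lintegral_indicator (hm hS),
    ← lintegral_indicator hS, ← lintegral_sub_right_eq_self _ c,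
    ← lintegral_const_mul _ ((measurable_lapDensity b).indicator hS)]
  refine lintegral_mono fun x => ?_
  by_cases hx : x ∈ S
  · have hx' : x - c ∈ (fun x : ℝ => x + c) ⁻¹' S := by simpa using hx
    rw [Set.indicator_of_mem hx, Set.indicator_of_mem hx', ← ENNReal.ofReal_mul (by positivity)]
    refine ENNReal.ofReal_le_ofReal ?_
    rw [← mul_div_assoc, ← Real.exp_add]
    gcongr
    rw [← add_div]
    gcongr
    have := abs_sub_abs_le_abs_sub x (x - c)
    rw [sub_sub_cancel] at this
    linarith
  · have hx' : x - c ∉ (fun x : ℝ => x + c) ⁻¹' S := by simpa using hx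
    rw [Set.indicator_of_notMem hx, Set.indicator_of_notMem hx']
    simp

/-- Half of the exponent is spent on the tail; the other half is twice the density of `Lap(2b)`,
whose mass is at most 1. The lossy exponent is harmless and no tail integral is computed. -/
theorem lap_abs_gt_le {b : ℝ} (hb : 0 < b) (t : ℝ) :
    lap b {x | t < |x|} ≤ ENNReal.ofReal (2 * Real.exp (-t / (2 * b))) := by
  have := isProbabilityMeasure_lap (b := 2 * b) (by positivity)
  have hS : MeasurableSet {x : ℝ | t < |x|} := measurableSet_lt measurable_const measurable_id.abs
  calc lap b {x | t < |x|}
      = ∫⁻ x in {x | t < |x|}, ENNReal.ofReal (Real.exp (-|x| / b) / (2 * b)) := by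
        rw [lap, withDensity_apply _ hS]
    _ ≤ ∫⁻ x in {x | t < |x|}, ENNReal.ofReal (2 * Real.exp (-t / (2 * b))) *
          ENNReal.ofReal (Real.exp (-|x| / (2 * b)) / (2 * (2 * b))) := by
        refine setLIntegral_mono' hS fun x hx => ?_
        rw [← ENNReal.ofReal_mul (by positivity)]
        refine ENNReal.ofReal_le_ofReal ?_
        have hx : t < |x| := hx
        have h1 : Real.exp (-|x| / b) ≤ Real.exp (-t / (2 * b)) * Real.exp (-|x| / (2 * b)) := by
          rw [← Real.exp_add, ← add_div]
          refine Real.exp_le_exp.2 ?_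
          rw [div_le_div_iff₀ hb (by positivity)]
          nlinarith
        calc Real.exp (-|x| / b) / (2 * b)
            ≤ (Real.exp (-t / (2 * b)) * Real.exp (-|x| / (2 * b))) / (2 * b) := by gcongr
          _ = _ := by field_simp
    _ = ENNReal.ofReal (2 * Real.exp (-t / (2 * b))) * lap (2 * b) {x | t < |x|} := by
        rw [lintegral_const_mul _ (measurable_lapDensity (2 * b)), lap,
          withDensity_apply _ hS]
    _ ≤ _ := mul_le_of_le_one_right' prob_le_one

/-! ### The index that is selected -/

theorem firstAbove_eq_some {k : ℕ} {T : ℝ} {g : Fin k → WithTop ℝ} {ρ : ℝ} {ν : Fin k → ℝ}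
    {i : Fin k} : firstAbove T g ρ ν = some i ↔
      ((T + ρ : ℝ) : WithTop ℝ) ≤ g i + ((ν i : ℝ) : WithTop ℝ) ∧
        ∀ j < i, ¬ ((T + ρ : ℝ) : WithTop ℝ) ≤ g j + ((ν j : ℝ) : WithTop ℝ) := by
  simp only [firstAbove, Fin.find?_eq_some_iff, decide_eq_true_eq, decide_eq_false_iff_not]

theorem firstAbove_eq_none {k : ℕ} {T : ℝ} {g : Fin k → WithTop ℝ} {ρ : ℝ} {ν : Fin k → ℝ} :
    firstAbove T g ρ ν = none ↔
      ∀ j, ¬ ((T + ρ : ℝ) : WithTop ℝ) ≤ g j + ((ν j : ℝ) : WithTop ℝ) := by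
  simp only [firstAbove, Fin.find?_eq_none_iff, decide_eq_false_iff_not]

theorem measurableSet_coe_le_add {α : Type*} [MeasurableSpace α] {s t : α → ℝ}
    {u : α → WithTop ℝ} (hs : Measurable s) (ht : Measurable t) (hu : Measurable u) :
    MeasurableSet {x | ((s x : ℝ) : WithTop ℝ) ≤ u x + ((t x : ℝ) : WithTop ℝ)} := by
  have : {x | ((s x : ℝ) : WithTop ℝ) ≤ u x + ((t x : ℝ) : WithTop ℝ)} =
      {x | u x = ⊤} ∪ {x | s x ≤ (u x).untopD 0 + t x} ∩ {x | u x = ⊤}ᶜ := by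
    ext x
    simp only [Set.mem_ofPred_eq, Set.mem_union, Set.mem_inter_iff, Set.mem_compl_iff]
    cases h : u x with
    | top => simp
    | coe y => simp [← WithTop.coe_add]
  rw [this]
  have h1 : MeasurableSet {x | u x = ⊤} := hu (measurableSet_singleton _)
  exact h1.union ((measurableSet_le hs ((hu.untopD 0).add ht)).inter h1.compl)

theorem measurable_to_option_fin {α : Type*} [MeasurableSpace α] {k : ℕ} {f : α → Option (Fin k)}
    (h : ∀ o, MeasurableSet {x | f x = o}) : Measurable f := by
  intro S _
  have : f ⁻¹' S = ⋃ o ∈ S, {x | f x = o} := by ext; simp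
  rw [this]
  exact MeasurableSet.biUnion S.to_countable fun o _ => h o

theorem measurable_firstAbove {α : Type*} [MeasurableSpace α] {k : ℕ} (T : ℝ)
    {g : α → Fin k → WithTop ℝ} {ρ : α → ℝ} {ν : α → Fin k → ℝ} (hg : Measurable g)
    (hρ : Measurable ρ) (hν : Measurable ν) :
    Measurable fun x => firstAbove T (g x) (ρ x) (ν x) := by
  have hj : ∀ j, MeasurableSet {x | ((T + ρ x : ℝ) : WithTop ℝ) ≤
      g x j + ((ν x j : ℝ) : WithTop ℝ)} := fun j =>
    measurableSet_coe_le_add (hρ.const_add T) ((measurable_pi_apply j).comp hν)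
      ((measurable_pi_apply j).comp hg)
  refine measurable_to_option_fin fun o => ?_
  cases o with
  | none =>
    simp only [firstAbove_eq_none, Set.ofPred_forall]
    exact MeasurableSet.iInter fun j => (hj j).compl
  | some i =>
    simp only [firstAbove_eq_some, Set.ofPred_and, Set.ofPred_forall]
    exact (hj i).inter (MeasurableSet.iInter fun j => MeasurableSet.iInter fun _ => (hj j).compl)

theorem absErr_coe (v x : ℝ) : absErr v (x : WithTop ℝ) = ((|v - x| : ℝ) : WithTop ℝ) := rfl

theorem absErr_top (v : ℝ) : absErr v ⊤ = ⊤ := rfl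

theorem measurable_absErr (v : ℝ) : Measurable (absErr v) := by
  refine WithTop.measurable_of_measurable_comp_coe ?_
  simp only [absErr_coe]
  fun_prop

/-! ### Privacy and measurability of a single correction -/

theorem noise_map_add_le {k : ℕ} {b₀ b : ℝ} (hb₀ : 0 < b₀) (hb : 0 < b) (c : ℝ) (d : Fin k → ℝ) :
    ((lap b₀).prod (Measure.pi fun _ : Fin k => lap b)).map
        (Prod.map (fun x => x + c) fun ν j => ν j + d j) ≤
      ENNReal.ofReal (Real.exp (|c| / b₀ + ∑ j, |d j| / b)) •
        (lap b₀).prod (Measure.pi fun _ : Fin k => lap b) := by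
  have := isProbabilityMeasure_lap hb₀
  have := isProbabilityMeasure_lap hb
  have hm : ∀ c : ℝ, Measurable fun x : ℝ => x + c := fun c => by fun_prop
  have hP : ∀ j, IsProbabilityMeasure ((lap b).map fun x => x + d j) := fun j =>
    Measure.isProbabilityMeasure_map (hm _).aemeasurable
  have hpi : (Measure.pi fun _ : Fin k => lap b).map (fun ν j => ν j + d j) ≤
      (∏ j, ENNReal.ofReal (Real.exp (|d j| / b))) • Measure.pi fun _ : Fin k => lap b := by
    rw [Measure.pi_map_pi (f := fun j x => x + d j) fun j => (hm _).aemeasurable,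
      ← pi_measure_smul _ fun j => ENNReal.ofReal_ne_top]
    exact pi_measure_mono fun j => lap_map_add_le hb (d j)
  rw [← Measure.map_prod_map _ _ (hm c) (by fun_prop)]
  refine (Measure.prod_mono (lap_map_add_le hb₀ c) hpi).trans ?_
  rw [Measure.prod_smul_left, Measure.prod_smul_right, smul_smul, Real.exp_add, Real.exp_sum,
    ENNReal.ofReal_mul (by positivity), ENNReal.ofReal_prod_of_nonneg fun _ _ => by positivity]

theorem le_of_forall_singleton {α : Type*} [Countable α] [MeasurableSpace α]
    [MeasurableSingletonClass α] {μ ν : Measure α} (h : ∀ x, μ {x} ≤ ν {x}) : μ ≤ ν := by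
  refine Measure.le_iff.2 fun S hS => ?_
  rw [← Measure.tsum_indicator_apply_singleton μ S hS,
    ← Measure.tsum_indicator_apply_singleton ν S hS]
  exact ENNReal.tsum_le_tsum fun x => Set.indicator_le_indicator (h x)

theorem aboveThreshold_apply {k : ℕ} (ε T : ℝ) (g : Fin k → WithTop ℝ) (S : Set (Option (Fin k))) :
    aboveThreshold ε T g S = ((lap (2 / ε)).prod (Measure.pi fun _ : Fin k => lap (4 / ε)))
      {n | firstAbove T g n.1 n.2 ∈ S} := by
  rw [aboveThreshold, Measure.map_apply
    (measurable_firstAbove T measurable_const measurable_fst measurable_snd) trivial]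
  rfl

theorem coe_le_add_shift {s s' t t' : ℝ} {x y : WithTop ℝ} (hxy : x ≤ y + 1)
    (h : s' + t + 1 ≤ s + t') (hx : ((s : ℝ) : WithTop ℝ) ≤ x + (t : ℝ)) :
    ((s' : ℝ) : WithTop ℝ) ≤ y + (t' : ℝ) := by
  cases y with
  | top => simp
  | coe y =>
    cases x with
    | top => exact absurd hxy (by rw [top_le_iff]; exact WithTop.coe_ne_top (a := y + 1))
    | coe x =>
      rw [← WithTop.coe_add, WithTop.coe_le_coe] at *
      have hxy : x ≤ y + 1 := by exact_mod_cast hxy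
      linarith

/-- For each outcome separately, a shift of the noise maps the runs on `g` with that outcome into
runs on `g'` with the same outcome. The unit shift of `ρ` costs `η / 2`, and the shift of `ν` at
most `η / 2`. -/
theorem aboveThreshold_le {k : ℕ} {η : ℝ} (hη : 0 < η) (T : ℝ) {g g' : Fin k → WithTop ℝ}
    (h : ∀ i, g i ≤ g' i + 1) (h' : ∀ i, g' i ≤ g i + 1) :
    aboveThreshold η T g ≤ ENNReal.ofReal (Real.exp η) • aboveThreshold η T g' := by
  have key : ∀ (o : Option (Fin k)) (d : Fin k → ℝ), (∑ j, |d j| / (4 / η)) ≤ η / 2 →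
      (∀ ρ ν, firstAbove T g ρ ν = o → firstAbove T g' (ρ + 1) (fun j => ν j + d j) = o) →
      aboveThreshold η T g {o} ≤
        ENNReal.ofReal (Real.exp η) * aboveThreshold η T g' {o} := by
    intro o d hd hmap
    have hm : Measurable (Prod.map (fun x : ℝ => x + 1) fun (ν : Fin k → ℝ) j => ν j + d j) := by
      fun_prop
    have hS : MeasurableSet {n : ℝ × (Fin k → ℝ) | firstAbove T g' n.1 n.2 ∈ ({o} : Set _)} :=
      measurable_firstAbove T measurable_const measurable_fst measurable_snd
        (t := ({o} : Set (Option (Fin k)))) trivial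
    rw [aboveThreshold_apply, aboveThreshold_apply]
    calc _ ≤ (((lap (2 / η)).prod (Measure.pi fun _ : Fin k => lap (4 / η))).map
        (Prod.map (fun x => x + 1) fun ν j => ν j + d j))
          {n | firstAbove T g' n.1 n.2 ∈ ({o} : Set _)} := by
          rw [Measure.map_apply hm hS]
          exact measure_mono fun n hn => hmap n.1 n.2 hn
      _ ≤ _ := by
          refine (noise_map_add_le (by positivity) (by positivity) 1 d _).trans ?_
          rw [Measure.smul_apply, smul_eq_mul]
          gcongr
          rw [abs_one, one_div_div]
          linarith
  refine le_of_forall_singleton fun o => ?_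
  rw [Measure.smul_apply, smul_eq_mul]
  cases o with
  | none =>
    -- With the threshold one higher, values that grow by at most one still fail their tests.
    refine key none 0 (by simp; positivity) fun ρ ν hn => ?_
    rw [firstAbove_eq_none] at hn ⊢
    exact fun j hj => hn j (coe_le_add_shift (h' j) (by simp; linarith) hj)
  | some i =>
    -- The selected index needs 2: one for the raised threshold, one for a possible drop of its
    -- value.
    refine key (some i) (Pi.single i 2) ?_ fun ρ ν hn => ?_
    · rw [Finset.sum_eq_single i (fun j _ hj => by simp [hj]) (by simp)]
      simp only [Pi.single_eq_same, abs_two]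
      rw [div_div_eq_mul_div]
      linarith
    · rw [firstAbove_eq_some] at hn ⊢
      refine ⟨coe_le_add_shift (h i) (by simp; linarith) hn.1, fun j hj hc => hn.2 j hj ?_⟩
      exact coe_le_add_shift (h' j) (by simp [hj.ne]; linarith) hc

theorem measurable_of_fin_option {k : ℕ} {β : Type*} [MeasurableSpace β]
    (f : Option (Fin k) → β) : Measurable f := measurable_from_top

theorem permutedAboveThreshold_apply {k : ℕ} (ε T : ℝ) (f : Fin k → WithTop ℝ)
    (S : Set (Option (Fin k))) : permutedAboveThreshold ε T f S =
      (k.factorial : ℝ≥0∞)⁻¹ * ∑ π : Equiv.Perm (Fin k),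
        aboveThreshold ε T (fun i => f (π i)) {o | Option.map π o ∈ S} := by
  rw [permutedAboveThreshold, Measure.smul_apply, smul_eq_mul, Measure.finsetSum_apply]
  congr 1
  refine Finset.sum_congr rfl fun π _ => ?_
  rw [Measure.map_apply (measurable_of_fin_option _) (show MeasurableSet S from trivial)]
  rfl

theorem permutedAboveThreshold_le {k : ℕ} {η : ℝ} (hη : 0 < η) (T : ℝ) {f f' : Fin k → WithTop ℝ}
    (h : ∀ i, f i ≤ f' i + 1) (h' : ∀ i, f' i ≤ f i + 1) :
    permutedAboveThreshold η T f ≤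
      ENNReal.ofReal (Real.exp η) • permutedAboveThreshold η T f' := by
  refine Measure.le_iff.2 fun S _ => ?_
  rw [Measure.smul_apply, smul_eq_mul, permutedAboveThreshold_apply,
    permutedAboveThreshold_apply, mul_left_comm]
  refine mul_le_mul' le_rfl ?_
  rw [Finset.mul_sum]
  refine Finset.sum_le_sum fun π _ => ?_
  exact aboveThreshold_le hη T (fun i => h (π i)) (fun i => h' (π i)) _

theorem isProbabilityMeasure_aboveThreshold {k : ℕ} {η : ℝ} (hη : 0 < η) (T : ℝ)
    (g : Fin k → WithTop ℝ) : IsProbabilityMeasure (aboveThreshold η T g) := by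
  have := isProbabilityMeasure_lap (b := 2 / η) (by positivity)
  have := isProbabilityMeasure_lap (b := 4 / η) (by positivity)
  exact Measure.isProbabilityMeasure_map
    (measurable_firstAbove T measurable_const measurable_fst measurable_snd).aemeasurable

theorem isProbabilityMeasure_permutedAboveThreshold {k : ℕ} {η : ℝ} (hη : 0 < η) (T : ℝ)
    (f : Fin k → WithTop ℝ) : IsProbabilityMeasure (permutedAboveThreshold η T f) := by
  constructor
  have := fun g : Fin k → WithTop ℝ => isProbabilityMeasure_aboveThreshold hη T g
  rw [permutedAboveThreshold_apply]
  simp only [Set.mem_univ, Set.ofPred_true, measure_univ, Finset.sum_const, Finset.card_univ,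
    Fintype.card_perm, Fintype.card_fin, nsmul_eq_mul, mul_one]
  exact ENNReal.inv_mul_cancel (by simpa using k.factorial_ne_zero) (ENNReal.natCast_ne_top _)

theorem measurable_aboveThreshold_apply {k : ℕ} {α : Type*} [MeasurableSpace α] (η T : ℝ)
    {g : α → Fin k → WithTop ℝ} (hg : Measurable g) (S : Set (Option (Fin k))) :
    Measurable fun x => aboveThreshold η T (g x) S := by
  simp only [aboveThreshold_apply]
  have hS : MeasurableSet {p : α × ℝ × (Fin k → ℝ) | firstAbove T (g p.1) p.2.1 p.2.2 ∈ S} :=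
    measurable_firstAbove T (hg.comp measurable_fst) (measurable_fst.comp measurable_snd)
      (measurable_snd.comp measurable_snd) (t := S) trivial
  exact measurable_measure_prodMk_left hS

theorem measurable_permutedAboveThreshold_apply {k : ℕ} {α : Type*} [MeasurableSpace α] (η T : ℝ)
    {f : α → Fin k → WithTop ℝ} (hf : Measurable f) (S : Set (Option (Fin k))) :
    Measurable fun x => permutedAboveThreshold η T (f x) S := by
  simp only [permutedAboveThreshold_apply]
  refine Measurable.const_mul (Finset.measurable_sum _ fun π _ => ?_) _
  exact measurable_aboveThreshold_apply η T
    (measurable_pi_iff.2 fun i => (measurable_pi_apply (π i)).comp hf) _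

/-- The law of the answers after the index `o` has been selected. -/
def answerLaw {k : ℕ} (v : Fin k → ℝ) (ε : ℝ) (a : Fin k → WithTop ℝ) :
    Option (Fin k) → Measure (Fin k → WithTop ℝ)
  | none => Measure.dirac a
  | some i => (lap (2 / ε)).map fun z => Function.update a i ((v i + z : ℝ) : WithTop ℝ)

theorem correction_eq_bind {k : ℕ} (v : Fin k → ℝ) (ε T : ℝ) (a : Fin k → WithTop ℝ) :
    correction v ε T a = (permutedAboveThreshold (0.5 * ε) T fun i => absErr (v i) (a i)).bind
      (answerLaw v ε a) := by
  rw [correction]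
  congr 1

theorem measurable_update_answer {k : ℕ} (v : Fin k → ℝ) (i : Fin k) :
    Measurable fun p : (Fin k → WithTop ℝ) × ℝ =>
      Function.update p.1 i ((v i + p.2 : ℝ) : WithTop ℝ) := by
  refine measurable_pi_iff.2 fun j => ?_
  by_cases hj : j = i
  · subst hj
    simp only [Function.update_self]
    fun_prop
  · simp only [Function.update_of_ne hj]
    fun_prop

theorem measurable_update_answer_right {k : ℕ} (v : Fin k → ℝ) (a : Fin k → WithTop ℝ)
    (i : Fin k) : Measurable fun z : ℝ => Function.update a i ((v i + z : ℝ) : WithTop ℝ) :=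
  (measurable_update_answer v i).comp measurable_prodMk_left

theorem answerLaw_some_apply {k : ℕ} (v : Fin k → ℝ) (ε : ℝ) (a : Fin k → WithTop ℝ) (i : Fin k)
    {S : Set (Fin k → WithTop ℝ)} (hS : MeasurableSet S) :
    answerLaw v ε a (some i) S =
      lap (2 / ε) {z | Function.update a i ((v i + z : ℝ) : WithTop ℝ) ∈ S} := by
  rw [answerLaw, Measure.map_apply (measurable_update_answer_right v a i) hS]
  rfl

theorem isProbabilityMeasure_answerLaw {k : ℕ} (v : Fin k → ℝ) {ε : ℝ} (hε : 0 < ε)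
    (a : Fin k → WithTop ℝ) (o : Option (Fin k)) : IsProbabilityMeasure (answerLaw v ε a o) := by
  have := isProbabilityMeasure_lap (b := 2 / ε) (by positivity)
  cases o with
  | none =>
    exact (inferInstance : IsProbabilityMeasure (Measure.dirac a))
  | some i =>
    exact Measure.isProbabilityMeasure_map (measurable_update_answer_right v a i).aemeasurable

theorem correction_apply {k : ℕ} (v : Fin k → ℝ) (ε T : ℝ) (a : Fin k → WithTop ℝ)
    {S : Set (Fin k → WithTop ℝ)} (hS : MeasurableSet S) :
    correction v ε T a S = ∑ o, answerLaw v ε a o S *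
      permutedAboveThreshold (0.5 * ε) T (fun i => absErr (v i) (a i)) {o} := by
  rw [correction_eq_bind, Measure.bind_apply hS (measurable_of_fin_option _).aemeasurable,
    lintegral_fintype]

theorem lintegral_correction {k : ℕ} (v : Fin k → ℝ) (ε T : ℝ) (a : Fin k → WithTop ℝ)
    {f : (Fin k → WithTop ℝ) → ℝ≥0∞} (hf : Measurable f) :
    ∫⁻ x, f x ∂correction v ε T a = ∫⁻ o, ∫⁻ x, f x ∂answerLaw v ε a o
      ∂permutedAboveThreshold (0.5 * ε) T (fun i => absErr (v i) (a i)) := by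
  rw [correction_eq_bind, Measure.lintegral_bind (measurable_of_fin_option _).aemeasurable
    hf.aemeasurable]

theorem isProbabilityMeasure_correction {k : ℕ} (v : Fin k → ℝ) {ε : ℝ} (hε : 0 < ε) (T : ℝ)
    (a : Fin k → WithTop ℝ) : IsProbabilityMeasure (correction v ε T a) := by
  constructor
  have := isProbabilityMeasure_permutedAboveThreshold (η := 0.5 * ε) (by positivity) T
    fun i => absErr (v i) (a i)
  have := isProbabilityMeasure_answerLaw v hε a
  rw [correction_eq_bind, Measure.bind_apply MeasurableSet.univ
    (measurable_of_fin_option _).aemeasurable]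
  simp

theorem measurable_correction {k : ℕ} (v : Fin k → ℝ) (ε T : ℝ) :
    Measurable (correction v ε T) := by
  refine Measure.measurable_of_measurable_coe _ fun S hS => ?_
  simp only [correction_apply v ε T _ hS]
  refine Finset.measurable_sum _ fun o _ => Measurable.mul ?_ ?_
  · cases o with
    | none => exact (Measure.measurable_coe hS).comp Measure.measurable_dirac
    | some i =>
      simp only [answerLaw_some_apply v ε _ i hS]
      exact measurable_measure_prodMk_left (measurable_update_answer v i hS)
  · exact measurable_permutedAboveThreshold_apply _ T
      (measurable_pi_iff.2 fun i => (measurable_absErr (v i)).comp (measurable_pi_apply i)) _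

theorem absErr_le_add_one {v v' : ℝ} (h : |v - v'| ≤ 1) (a : WithTop ℝ) :
    absErr v a ≤ absErr v' a + 1 := by
  cases a with
  | top => simp [absErr_top]
  | coe x =>
    rw [absErr_coe, absErr_coe]
    have : |v - x| ≤ |v' - x| + 1 := by
      have := abs_sub_le v v' x
      linarith
    exact_mod_cast this

theorem answerLaw_le {k : ℕ} {v v' : Fin k → ℝ} (h : ∀ i, |v i - v' i| ≤ 1) {ε : ℝ} (hε : 0 < ε)
    (a : Fin k → WithTop ℝ) (o : Option (Fin k)) :
    answerLaw v ε a o ≤ ENNReal.ofReal (Real.exp (0.5 * ε)) • answerLaw v' ε a o := by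
  refine Measure.le_iff.2 fun S hS => ?_
  rw [Measure.smul_apply, smul_eq_mul]
  cases o with
  | none =>
    refine le_mul_of_one_le_left' ?_
    rw [ENNReal.one_le_ofReal]
    exact Real.one_le_exp (by positivity)
  | some i =>
    have hm : Measurable fun x : ℝ => x + (v i - v' i) := by fun_prop
    have hS' : MeasurableSet {z | Function.update a i ((v' i + z : ℝ) : WithTop ℝ) ∈ S} :=
      measurable_update_answer_right v' a i hS
    rw [answerLaw_some_apply _ _ _ _ hS, answerLaw_some_apply _ _ _ _ hS]
    calc _ = (lap (2 / ε)).map (fun x => x + (v i - v' i))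
          {z | Function.update a i ((v' i + z : ℝ) : WithTop ℝ) ∈ S} := by
          rw [Measure.map_apply hm hS']
          congr 1
          ext z
          simp only [Set.mem_ofPred_eq, Set.mem_preimage]
          rw [show v' i + (z + (v i - v' i)) = v i + z by ring]
      _ ≤ _ := by
          refine (lap_map_add_le (by positivity) _ _).trans ?_
          rw [Measure.smul_apply, smul_eq_mul]
          gcongr
          rw [div_div_eq_mul_div]
          nlinarith [h i]

/-- The selection and the noisy answer each spend half of `ε`. -/
theorem correction_le {k : ℕ} {v v' : Fin k → ℝ} (h : ∀ i, |v i - v' i| ≤ 1) {ε : ℝ} (hε : 0 < ε)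
    (T : ℝ) (a : Fin k → WithTop ℝ) :
    correction v ε T a ≤ ENNReal.ofReal (Real.exp ε) • correction v' ε T a := by
  refine Measure.le_iff.2 fun S hS => ?_
  have h' : ∀ i, |v' i - v i| ≤ 1 := fun i => by rw [abs_sub_comm]; exact h i
  rw [Measure.smul_apply, smul_eq_mul, correction_apply _ _ _ _ hS, correction_apply _ _ _ _ hS,
    Finset.mul_sum]
  refine Finset.sum_le_sum fun o _ => ?_
  refine (mul_le_mul' (answerLaw_le h hε a o S) (permutedAboveThreshold_le (by positivity) T
    (fun i => absErr_le_add_one (h i) (a i)) (fun i => absErr_le_add_one (h' i) (a i)) {o})).trans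
    (le_of_eq ?_)
  rw [Measure.smul_apply, Measure.smul_apply, smul_eq_mul, smul_eq_mul, mul_mul_mul_comm,
    ← ENNReal.ofReal_mul (by positivity), ← Real.exp_add]
  congr 3
  ring

/-! ### Advanced composition -/

/-- The dual form of a bound on the Rényi divergence of `P` from `Q`: for a measurable `h ≥ 0`, the
integral of `h` under `P` is at most `M` times the `L^p` norm of `h` under `Q`. -/
def HolderBound {Ω : Type*} [MeasurableSpace Ω] (p : ℝ) (M : ℝ≥0∞) (P Q : Measure Ω) : Prop :=
  ∀ h : Ω → ℝ≥0∞, Measurable h → ∫⁻ x, h x ∂P ≤ M * (∫⁻ x, h x ^ p ∂Q) ^ (1 / p)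

theorem holderBound_dirac {Ω : Type*} [MeasurableSpace Ω] {p : ℝ} (hp : 0 < p) (a : Ω) :
    HolderBound p 1 (Measure.dirac a) (Measure.dirac a) := by
  intro h hh
  rw [lintegral_dirac' a hh, lintegral_dirac' a (hh.pow_const p), one_mul, ← ENNReal.rpow_mul,
    mul_one_div_cancel hp.ne', ENNReal.rpow_one]

/-- The outer bound is applied to the test function `x ↦ (∫ f ^ p ∂K' x) ^ (1 / p)`, whose `p`-th
power integrates to the integral of `f ^ p` under the composite. The inner bound is needed pointwise
only, so adaptivity costs nothing. -/
theorem HolderBound.bind {Ω Ω' : Type*} [MeasurableSpace Ω] [MeasurableSpace Ω'] {p : ℝ}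
    (hp : 0 < p) {M M' : ℝ≥0∞} {P Q : Measure Ω} {K K' : Ω → Measure Ω'}
    (hPQ : HolderBound p M P Q) (hK : Measurable K) (hK' : Measurable K')
    (h : ∀ x, HolderBound p M' (K x) (K' x)) :
    HolderBound p (M * M') (P.bind K) (Q.bind K') := by
  intro f hf
  have hfp : Measurable fun y => f y ^ p := hf.pow_const p
  have hg : Measurable fun x => ∫⁻ y, f y ^ p ∂K' x := (Measure.measurable_lintegral hfp).comp hK'
  rw [Measure.lintegral_bind hK.aemeasurable hf.aemeasurable,
    Measure.lintegral_bind hK'.aemeasurable hfp.aemeasurable]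
  calc ∫⁻ x, ∫⁻ y, f y ∂K x ∂P ≤ ∫⁻ x, M' * (∫⁻ y, f y ^ p ∂K' x) ^ (1 / p) ∂P :=
        lintegral_mono fun x => h x f hf
    _ = M' * ∫⁻ x, (∫⁻ y, f y ^ p ∂K' x) ^ (1 / p) ∂P :=
        lintegral_const_mul _ (hg.pow_const _)
    _ ≤ M' * (M * (∫⁻ x, ((∫⁻ y, f y ^ p ∂K' x) ^ (1 / p)) ^ p ∂Q) ^ (1 / p)) :=
        mul_le_mul' le_rfl (hPQ _ (hg.pow_const _))
    _ = _ := by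
        simp_rw [← ENNReal.rpow_mul, one_div_mul_cancel hp.ne', ENNReal.rpow_one]
        ring

/-- Second-order expansion of `exp (α * log x)` combined with `log x ≤ x - 1`. For a likelihood
ratio `x` the linear term has mean zero, so only the quadratic term survives integration. -/
theorem rpow_le_of_abs_log_le {α η x : ℝ} (hα : 1 ≤ α) (hη : α * η ≤ 1)
    (hx₁ : Real.exp (-η) ≤ x) (hx₂ : x ≤ Real.exp η) :
    x ^ α ≤ 1 + α * (x - 1) + (α * η) ^ 2 := by
  have hx : 0 < x := (Real.exp_pos _).trans_le hx₁
  set u := Real.log x with hu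
  have hxu : x = Real.exp u := (Real.exp_log hx).symm
  have hu' : |u| ≤ η := by
    rw [hxu, Real.exp_le_exp] at hx₁ hx₂
    exact abs_le.2 ⟨hx₁, hx₂⟩
  have hau : |α * u| ≤ α * η := by
    rw [abs_mul, abs_of_pos (by linarith)]
    gcongr
  have h1 := (abs_le.1 (Real.abs_exp_sub_one_sub_id_le (hau.trans hη))).2
  have h2 : (α * u) ^ 2 ≤ (α * η) ^ 2 := sq_le_sq.2 (hau.trans (le_abs_self _))
  have h3 := Real.add_one_le_exp u
  have h4 : x ^ α = Real.exp (α * u) := by rw [hxu, ← Real.exp_mul, mul_comm]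
  rw [h4, hxu]
  nlinarith

theorem lintegral_rnDeriv_rpow_le {Ω : Type*} [MeasurableSpace Ω] {P Q : Measure Ω}
    [IsProbabilityMeasure P] [IsProbabilityMeasure Q] {η α : ℝ} (hα : 1 ≤ α)
    (h : P ≤ ENNReal.ofReal (Real.exp η) • Q) (h' : Q ≤ ENNReal.ofReal (Real.exp η) • P) :
    ∫⁻ x, P.rnDeriv Q x ^ α ∂Q ≤ ENNReal.ofReal (Real.exp ((α * η) ^ 2)) := by
  have hac : P ≪ Q := (Measure.absolutelyContinuous_of_le h).trans
    (Measure.smul_absolutelyContinuous)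
  have hf : Measurable (P.rnDeriv Q) := Measure.measurable_rnDeriv P Q
  have hset : ∀ s, MeasurableSet s → ∫⁻ x in s, P.rnDeriv Q x ∂Q = P s := fun s hs => by
    rw [← withDensity_apply _ hs, Measure.withDensity_rnDeriv_eq P Q hac]
  have hup : ∀ᵐ x ∂Q, P.rnDeriv Q x ≤ ENNReal.ofReal (Real.exp η) := by
    refine ae_le_of_forall_setLIntegral_le_of_sigmaFinite hf fun s hs _ => ?_
    rw [hset s hs, setLIntegral_const]
    exact h s
  have hlow : ∀ᵐ x ∂Q, ENNReal.ofReal (Real.exp (-η)) ≤ P.rnDeriv Q x := by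
    refine ae_le_of_forall_setLIntegral_le_of_sigmaFinite measurable_const fun s hs _ => ?_
    rw [hset s hs, setLIntegral_const]
    refine (mul_le_mul' le_rfl (h' s)).trans (le_of_eq ?_)
    rw [Measure.smul_apply, smul_eq_mul, ← mul_assoc, ← ENNReal.ofReal_mul (by positivity),
      ← Real.exp_add]
    simp
  have hα0 : 0 ≤ α := by linarith
  by_cases hαη : α * η ≤ 1
  -- The constant `α` stands on the left so that no subtraction occurs in `ℝ≥0∞`; it cancels because
  -- the ratio integrates to one.
  · have hpt : ∀ᵐ x ∂Q, P.rnDeriv Q x ^ α + ENNReal.ofReal α ≤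
        ENNReal.ofReal (1 + (α * η) ^ 2) + ENNReal.ofReal α * P.rnDeriv Q x := by
      filter_upwards [hup, hlow] with x hx₁ hx₂
      have hfin : P.rnDeriv Q x ≠ ∞ := (hx₁.trans_lt ENNReal.ofReal_lt_top).ne
      obtain ⟨y, hy0, hy⟩ : ∃ y : ℝ, 0 ≤ y ∧ P.rnDeriv Q x = ENNReal.ofReal y :=
        ⟨_, ENNReal.toReal_nonneg, (ENNReal.ofReal_toReal hfin).symm⟩
      rw [hy] at hx₁ hx₂ ⊢
      rw [ENNReal.ofReal_le_ofReal_iff (by positivity)] at hx₁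
      rw [ENNReal.ofReal_le_ofReal_iff hy0] at hx₂
      rw [ENNReal.ofReal_rpow_of_nonneg hy0 hα0, ← ENNReal.ofReal_add (by positivity) hα0,
        ← ENNReal.ofReal_mul hα0, ← ENNReal.ofReal_add (by positivity) (by positivity)]
      refine ENNReal.ofReal_le_ofReal ?_
      have := rpow_le_of_abs_log_le hα hαη hx₂ hx₁
      linarith
    have hint := lintegral_mono_ae hpt
    rw [lintegral_add_right _ measurable_const, lintegral_add_left measurable_const,
      lintegral_const_mul _ hf, lintegral_const, lintegral_const, ← setLIntegral_univ
      (P.rnDeriv Q), hset _ MeasurableSet.univ] at hint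
    simp only [measure_univ, mul_one] at hint
    refine ((ENNReal.add_le_add_iff_right ENNReal.ofReal_ne_top).1 hint).trans
      (ENNReal.ofReal_le_ofReal ?_)
    have := Real.add_one_le_exp ((α * η) ^ 2)
    linarith
  -- If `α * η > 1`, the crude pointwise bound `exp (α * η)` is already below `exp ((α * η) ^ 2)`.
  · calc ∫⁻ x, P.rnDeriv Q x ^ α ∂Q ≤ ∫⁻ x, ENNReal.ofReal (Real.exp ((α * η) ^ 2)) ∂Q := by
          refine lintegral_mono_ae ?_
          filter_upwards [hup] with x hx
          refine (ENNReal.rpow_le_rpow hx hα0).trans ?_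
          rw [ENNReal.ofReal_rpow_of_nonneg (by positivity) hα0, ← Real.exp_mul]
          refine ENNReal.ofReal_le_ofReal (Real.exp_le_exp.2 ?_)
          nlinarith
      _ = _ := by simp

theorem holderBound_of_le {Ω : Type*} [MeasurableSpace Ω] {P Q : Measure Ω}
    [IsProbabilityMeasure P] [IsProbabilityMeasure Q] {η α p : ℝ} (hαp : α.HolderConjugate p)
    (h : P ≤ ENNReal.ofReal (Real.exp η) • Q) (h' : Q ≤ ENNReal.ofReal (Real.exp η) • P) :
    HolderBound p (ENNReal.ofReal (Real.exp (α * η ^ 2))) P Q := by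
  intro f hf
  have hac : P ≪ Q := (Measure.absolutelyContinuous_of_le h).trans
    (Measure.smul_absolutelyContinuous)
  have hα : 0 < α := hαp.pos
  rw [← lintegral_rnDeriv_mul hac hf.aemeasurable]
  refine (ENNReal.lintegral_mul_le_Lp_mul_Lq Q hαp
    (Measure.measurable_rnDeriv P Q).aemeasurable hf.aemeasurable).trans ?_
  refine mul_le_mul' ?_ le_rfl
  refine (ENNReal.rpow_le_rpow (lintegral_rnDeriv_rpow_le hαp.lt.le h h')
    (by positivity)).trans (le_of_eq ?_)
  rw [ENNReal.ofReal_rpow_of_nonneg (by positivity) (by positivity), ← Real.exp_mul]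
  congr 2
  field_simp

/-! ### Privacy of the algorithm -/

theorem holderBound_correction {k : ℕ} {v v' : Fin k → ℝ} (h : ∀ i, |v i - v' i| ≤ 1) {ε : ℝ}
    (hε : 0 < ε) (T : ℝ) {α p : ℝ} (hαp : α.HolderConjugate p) (a : Fin k → WithTop ℝ) :
    HolderBound p (ENNReal.ofReal (Real.exp (α * ε ^ 2))) (correction v ε T a)
      (correction v' ε T a) := by
  have := isProbabilityMeasure_correction v hε T a
  have := isProbabilityMeasure_correction v' hε T a
  exact holderBound_of_le hαp (correction_le h hε T a)
    (correction_le (fun i => by rw [abs_sub_comm]; exact h i) hε T a)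

theorem holderBound_iterate_correction {k : ℕ} {v v' : Fin k → ℝ} (h : ∀ i, |v i - v' i| ≤ 1)
    {ε : ℝ} (hε : 0 < ε) (T : ℝ) {α p : ℝ} (hαp : α.HolderConjugate p) {c : ℝ}
    {μ μ' : Measure (Fin k → WithTop ℝ)}
    (hμ : HolderBound p (ENNReal.ofReal (Real.exp c)) μ μ') (n : ℕ) :
    HolderBound p (ENNReal.ofReal (Real.exp (c + α * (n * ε ^ 2))))
      ((fun μ => μ.bind (correction v ε T))^[n] μ)
      ((fun μ => μ.bind (correction v' ε T))^[n] μ') := by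
  induction n with
  | zero => simpa using hμ
  | succ n ih =>
    rw [Function.iterate_succ_apply', Function.iterate_succ_apply']
    have := ih.bind hαp.symm.pos (measurable_correction v ε T) (measurable_correction v' ε T)
      (holderBound_correction h hε T hαp)
    rw [← ENNReal.ofReal_mul (by positivity), ← Real.exp_add] at this
    convert this using 3
    push_cast
    ring

theorem holderBound_iterativeSV {k : ℕ} {v v' : Fin k → ℝ} (h : ∀ i, |v i - v' i| ≤ 1)
    {ε : ℕ → ℝ} (hε : ∀ l, 0 < ε (l + 1)) (m : ℕ → ℕ) (T : ℕ → ℝ) {α p : ℝ}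
    (hαp : α.HolderConjugate p) (L : ℕ) :
    HolderBound p
      (ENNReal.ofReal (Real.exp (α * ∑ l ∈ Finset.range L, (m (l + 1) : ℝ) * ε (l + 1) ^ 2)))
      (iterativeSV v ε m T L) (iterativeSV v' ε m T L) := by
  induction L with
  | zero => simpa [iterativeSV] using holderBound_dirac hαp.symm.pos _
  | succ l ih =>
    rw [Finset.sum_range_succ, mul_add]
    exact holderBound_iterate_correction h (hε l) (T (l + 1)) hαp ih (m (l + 1))

/-- An indicator as test function gives `P S ≤ e^c (Q S)^(1/p)`. The hypothesis `hc` says that `e^c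
≤ e^(ε/p) δ^(1/α)`, and Young's inequality splits the resulting product into the two summands. -/
theorem le_of_holderBound {Ω : Type*} [MeasurableSpace Ω] {P Q : Measure Ω} {α p c ε δ : ℝ}
    (hαp : α.HolderConjugate p) (hδ : 0 < δ) (hPQ : HolderBound p (ENNReal.ofReal (Real.exp c)) P Q)
    (hc : α * c + Real.log (1 / δ) ≤ ε * (α - 1)) {S : Set Ω} (hS : MeasurableSet S) :
    P S ≤ ENNReal.ofReal (Real.exp ε) * Q S + ENNReal.ofReal δ := by
  have hα : 0 < α := hαp.pos
  have hp : 0 < p := hαp.symm.pos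
  have h1 := hPQ (S.indicator fun _ => 1) (measurable_const.indicator hS)
  have h2 : ∀ x, (S.indicator (fun _ => (1 : ℝ≥0∞)) x) ^ p = S.indicator (fun _ => 1) x := by
    intro x
    by_cases hx : x ∈ S <;> simp [hx, hp]
  simp only [h2, lintegral_indicator_const hS, one_mul] at h1
  refine h1.trans ?_
  have h3 : ENNReal.ofReal (Real.exp c) ≤
      ENNReal.ofReal (Real.exp ε) ^ (1 / p) * ENNReal.ofReal δ ^ (1 / α) := by
    rw [ENNReal.ofReal_rpow_of_nonneg (by positivity) (by positivity),
      ENNReal.ofReal_rpow_of_nonneg hδ.le (by positivity), ← ENNReal.ofReal_mul (by positivity)]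
    refine ENNReal.ofReal_le_ofReal ?_
    rw [Real.rpow_def_of_pos hδ, ← Real.exp_mul, ← Real.exp_add]
    refine Real.exp_le_exp.2 ?_
    have hpi : 1 / p = 1 - 1 / α := by
      have := hαp.inv_add_inv_eq_one
      simp only [one_div]
      linarith
    rw [one_div, Real.log_inv] at hc
    rw [hpi]
    refine le_of_mul_le_mul_left ?_ hα
    have : α * (ε * (1 - 1 / α) + Real.log δ * (1 / α)) = ε * (α - 1) + Real.log δ := by
      field_simp
    rw [this]
    linarith
  have hconj : (1 / p) + (1 / α) = 1 := by
    have := hαp.inv_add_inv_eq_one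
    simp only [one_div]
    linarith
  calc ENNReal.ofReal (Real.exp c) * Q S ^ (1 / p)
      ≤ (ENNReal.ofReal (Real.exp ε) * Q S) ^ (1 / p) * ENNReal.ofReal δ ^ (1 / α) := by
        rw [ENNReal.mul_rpow_of_nonneg _ _ (by positivity)]
        refine (mul_le_mul' h3 le_rfl).trans (le_of_eq ?_)
        ring
    _ ≤ _ := by
        have := ENNReal.young_inequality ((ENNReal.ofReal (Real.exp ε) * Q S) ^ (1 / p))
          (ENNReal.ofReal δ ^ (1 / α)) hαp.symm
        rw [← ENNReal.rpow_mul, ← ENNReal.rpow_mul, one_div_mul_cancel hp.ne',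
          one_div_mul_cancel hα.ne', ENNReal.rpow_one, ENNReal.rpow_one] at this
        refine this.trans (add_le_add ?_ ?_)
        · refine ENNReal.div_le_of_le_mul (le_mul_of_one_le_right' ?_)
          rw [ENNReal.one_le_ofReal]
          exact hαp.symm.lt.le
        · refine ENNReal.div_le_of_le_mul (le_mul_of_one_le_right' ?_)
          rw [ENNReal.one_le_ofReal]
          exact hαp.lt.le

theorem kappa_pos : 0 < kappa := by norm_num [kappa]

theorem lam_pos : 0 < lam := by norm_num [lam]

theorem log_one_div_pos {δ : ℝ} (hδ : 0 < δ) (hδ' : δ ≤ 0.5) : 1 / 2 < Real.log (1 / δ) := by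
  have h1 : Real.log 2 ≤ Real.log (1 / δ) := by
    refine Real.log_le_log (by norm_num) ?_
    rw [le_div_iff₀ hδ]
    linarith
  have := Real.log_two_gt_d9
  linarith

theorem epsZero_pos {ε δ : ℝ} (hε : 0 < ε) (hδ : 0 < δ) (hδ' : δ ≤ 0.5) : 0 < epsZero ε δ := by
  have := log_one_div_pos hδ hδ'
  have : 0 < Real.sqrt (Real.log (1 / δ)) := Real.sqrt_pos.2 (by linarith)
  unfold epsZero
  positivity

theorem epsStage_pos {k : ℕ} (hk : 0 < k) {ε δ : ℝ} (hε : 0 < ε) (hδ : 0 < δ) (hδ' : δ ≤ 0.5)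
    {l : ℕ} (hl : 0 < l) : 0 < epsStage k ε δ l := by
  have := epsZero_pos hε hδ hδ'
  have := lam_pos
  have : 0 < Real.sqrt k := Real.sqrt_pos.2 (by positivity)
  have : 0 < Real.sqrt (l * lam ^ l) := Real.sqrt_pos.2 (by positivity)
  unfold epsStage
  positivity

theorem mCount_mul_epsStage_sq_le {k : ℕ} (hk : 0 < k) (ε δ : ℝ) (l : ℕ) :
    (mCount k (l + 1) : ℝ) * epsStage k ε δ (l + 1) ^ 2 ≤
      epsZero ε δ ^ 2 * (18 / 19 * (18 / 19) ^ l) := by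
  have hlam := lam_pos
  have hkap := kappa_pos
  have h1 : (mCount k (l + 1) : ℝ) ≤ kappa ^ (l + 1) * k := Nat.floor_le (by
    unfold mReal; positivity)
  have h2 : epsStage k ε δ (l + 1) ^ 2 =
      epsZero ε δ ^ 2 / k / (((l + 1 : ℕ) : ℝ) * lam ^ (l + 1)) := by
    rw [epsStage, mul_pow, div_pow, div_pow, one_pow, Real.sq_sqrt (by positivity),
      Real.sq_sqrt (by positivity)]
    ring
  rw [h2]
  calc _ ≤ kappa ^ (l + 1) * k * (epsZero ε δ ^ 2 / k / (((l + 1 : ℕ) : ℝ) * lam ^ (l + 1))) := by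
        gcongr
    _ = epsZero ε δ ^ 2 * ((kappa / lam) ^ (l + 1)) / ((l + 1 : ℕ) : ℝ) := by
        have : (k : ℝ) ≠ 0 := by positivity
        rw [div_pow]
        field_simp
    _ ≤ epsZero ε δ ^ 2 * ((kappa / lam) ^ (l + 1)) := by
        refine div_le_self (by positivity) ?_
        push_cast
        linarith [(Nat.cast_nonneg l : (0 : ℝ) ≤ l)]
    _ = _ := by
        rw [show kappa / lam = 18 / 19 by norm_num [kappa, lam], pow_succ' (18 / 19 : ℝ)]

theorem sum_mCount_mul_epsStage_sq_le {k : ℕ} (hk : 0 < k) (ε δ : ℝ) (L : ℕ) :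
    ∑ l ∈ Finset.range L, (mCount k (l + 1) : ℝ) * epsStage k ε δ (l + 1) ^ 2 ≤
      18 * epsZero ε δ ^ 2 := by
  refine (Finset.sum_le_sum fun l _ => mCount_mul_epsStage_sq_le hk ε δ l).trans ?_
  rw [← Finset.mul_sum, ← Finset.mul_sum, geom_sum_eq (by norm_num), mul_comm]
  have : (0 : ℝ) < (18 / 19) ^ L := by positivity
  gcongr
  rw [show (18 : ℝ) / 19 - 1 = -(1 / 19) by norm_num]
  linarith

theorem isDP_algorithm {D : Type*} {Nbr : D → D → Prop} {k : ℕ} {ε δ : ℝ} (hε : 0 < ε)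
    (hε1 : ε ≤ 1) (hδ : 0 < δ) (hδ' : δ ≤ 0.5) {q : Fin k → D → ℝ}
    (hq : ∀ i, SensitivityLeOne Nbr (q i)) : IsDP Nbr ε δ (algorithm ε δ q) := by
  intro X X' hX S hS
  rcases Nat.eq_zero_or_pos k with rfl | hk
  -- Here `Real.log 0 = 0` yields no stages, so the output does not depend on the dataset.
  · have h0 : numStages 0 = 0 := by simp [numStages]
    rw [algorithm, algorithm, h0]
    refine le_add_right (le_mul_of_one_le_left' ?_)
    rw [ENNReal.one_le_ofReal]
    exact Real.one_le_exp hε.le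
  · have hlog := log_one_div_pos hδ hδ'
    set ℓ := Real.log (1 / δ) with hℓ
    -- This order makes `ε * (α - 1) = 2 * ℓ`: one `ℓ` pays for `log (1 / δ)`, the other has to
    -- cover `α ^ 2 * s`. The 1000 in `epsZero` leaves ample room.
    have hαp : (1 + 2 * ℓ / ε).HolderConjugate (Real.conjExponent (1 + 2 * ℓ / ε)) :=
      Real.HolderConjugate.conjExponent (by
        have : 0 < 2 * ℓ / ε := by positivity
        linarith)
    refine le_of_holderBound hαp hδ (holderBound_iterativeSV (fun i => hq i X X' hX)
      (fun l => epsStage_pos hk hε hδ hδ' l.succ_pos) _ _ hαp _) ?_ hS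
    have hsum := sum_mCount_mul_epsStage_sq_le hk ε δ (numStages k)
    set s := ∑ l ∈ Finset.range (numStages k), (mCount k (l + 1) : ℝ) * epsStage k ε δ (l + 1) ^ 2
    have hα : 1 + 2 * ℓ / ε ≤ 4 * ℓ / ε := by
      rw [← sub_nonneg, show 4 * ℓ / ε - (1 + 2 * ℓ / ε) = (2 * ℓ - ε) / ε by field_simp; ring]
      exact div_nonneg (by linarith) hε.le
    have h0 : epsZero ε δ ^ 2 = ε ^ 2 / (10 ^ 6 * ℓ) := by
      rw [epsZero, div_pow, mul_pow, Real.sq_sqrt (by linarith), ← hℓ]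
      norm_num
    rw [h0] at hsum
    have hs0 : 0 ≤ s := Finset.sum_nonneg fun _ _ => by positivity
    have hα0 : 0 ≤ 1 + 2 * ℓ / ε := by positivity
    calc (1 + 2 * ℓ / ε) * ((1 + 2 * ℓ / ε) * s) + ℓ
        ≤ (4 * ℓ / ε) * ((4 * ℓ / ε) * (18 * (ε ^ 2 / (10 ^ 6 * ℓ)))) + ℓ := by gcongr
      _ = (288 / 10 ^ 6 + 1) * ℓ := by field_simp; ring
      _ ≤ 2 * ℓ := by gcongr; norm_num
      _ = ε * (1 + 2 * ℓ / ε - 1) := by field_simp; ring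

/-! ### Random permutations that avoid a set in the first positions -/

/-- The permutations that map none of the first `r` positions into `B`. -/
def avoidingPerms {k : ℕ} (B : Finset (Fin k)) (r : ℕ) : Finset (Equiv.Perm (Fin k)) :=
  {π | ∀ i : Fin k, (i : ℕ) < r → π i ∉ B}

theorem mem_avoidingPerms {k : ℕ} {B : Finset (Fin k)} {r : ℕ} {π : Equiv.Perm (Fin k)} :
    π ∈ avoidingPerms B r ↔ ∀ i : Fin k, (i : ℕ) < r → π i ∉ B := by
  simp [avoidingPerms]

theorem card_avoidingPerms_mul {k : ℕ} (B : Finset (Fin k)) (r : ℕ) :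
    (avoidingPerms B r).card * B.card =
      ∑ i, ((avoidingPerms B r).filter fun π => π i ∈ B).card := by
  simp only [Finset.card_filter]
  rw [Finset.sum_comm]
  have : ∀ π : Equiv.Perm (Fin k), ∑ i, (if π i ∈ B then 1 else 0) = B.card := fun π => by
    rw [Equiv.sum_comp π fun i => if i ∈ B then 1 else 0]
    simp
  simp [this]

/-- Exchanging the positions `i` and `r` is injective. It leaves the first `r` positions alone,
since `i` holds an element of `B` and so is not one of them. -/
theorem card_avoidingPerms_filter_le {k : ℕ} (B : Finset (Fin k)) (r i : Fin k) :
    ((avoidingPerms B r).filter fun π => π i ∈ B).card ≤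
      ((avoidingPerms B r).filter fun π => π r ∈ B).card := by
  refine Finset.card_le_card_of_injOn (fun π => π * Equiv.swap i r) ?_
    fun π _ π' _ h => mul_right_cancel h
  intro π hπ
  simp only [Finset.coe_filter, mem_avoidingPerms, Set.mem_ofPred_eq] at hπ ⊢
  refine ⟨fun j hj => ?_, by simpa using hπ.2⟩
  have h1 : j ≠ r := fun h => by simp [h] at hj
  have h2 : j ≠ i := fun h => hπ.1 j hj (h ▸ hπ.2)
  rw [Equiv.Perm.mul_apply, Equiv.swap_apply_of_ne_of_ne h2 h1]
  exact hπ.1 j hj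

/-- Every permutation places `B` in exactly `B.card` positions, and among avoiding permutations
position `r` is at least as likely as any other to hold an element of `B`. Hence at least the
fraction `B.card / k` of them stops avoiding `B` at position `r`. -/
theorem card_avoidingPerms_succ_le {k : ℕ} (B : Finset (Fin k)) (r : ℕ) :
    k * (avoidingPerms B (r + 1)).card ≤ (k - B.card) * (avoidingPerms B r).card := by
  have hBk : B.card ≤ k := by simpa using Finset.card_le_univ B
  rcases lt_or_ge r k with hr | hr
  · have hsplit := Finset.card_filter_add_card_filter_not (s := avoidingPerms B r)
      fun π => π ⟨r, hr⟩ ∈ B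
    have hsub : avoidingPerms B (r + 1) ⊆
        (avoidingPerms B r).filter fun π => ¬ π ⟨r, hr⟩ ∈ B := by
      intro π hπ
      rw [mem_avoidingPerms] at hπ
      rw [Finset.mem_filter, mem_avoidingPerms]
      exact ⟨fun i hi => hπ i (by omega), hπ _ (by simp)⟩
    have h1 := Finset.card_le_card hsub
    have h2 : (avoidingPerms B r).card * B.card ≤
        k * ((avoidingPerms B r).filter fun π => π ⟨r, hr⟩ ∈ B).card := by
      rw [card_avoidingPerms_mul]
      refine (Finset.sum_le_card_nsmul _ _ _ fun i _ =>
        card_avoidingPerms_filter_le B ⟨r, hr⟩ i).trans ?_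
      simp
    rw [Nat.sub_mul]
    refine Nat.le_sub_of_add_le ?_
    nlinarith
  · rcases B.eq_empty_or_nonempty with rfl | ⟨b, hb⟩
    · rw [Finset.card_empty, Nat.sub_zero]
      refine Nat.mul_le_mul_left _ (Finset.card_le_card fun π _ => ?_)
      simp [mem_avoidingPerms]
    · have : avoidingPerms B (r + 1) = ∅ := by
        refine Finset.eq_empty_of_forall_notMem fun π hπ => ?_
        rw [mem_avoidingPerms] at hπ
        exact hπ (π.symm b) (by omega) (by simpa using hb)
      simp [this]

theorem card_avoidingPerms_le {k : ℕ} (hk : 0 < k) (B : Finset (Fin k)) (r : ℕ) :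
    ((avoidingPerms B r).card : ℝ) ≤ (1 - B.card / k) ^ r * k.factorial := by
  have hBk : B.card ≤ k := by simpa using Finset.card_le_univ B
  have hk' : (0 : ℝ) < k := by positivity
  have hx : (0 : ℝ) ≤ 1 - B.card / k := by
    rw [sub_nonneg, div_le_one hk']
    exact_mod_cast hBk
  induction r with
  | zero =>
    have : (avoidingPerms B 0).card ≤ k.factorial := by
      simpa [Fintype.card_perm] using Finset.card_le_univ (avoidingPerms B 0)
    simpa using this
  | succ r ih =>
    have h := card_avoidingPerms_succ_le B r
    have h' : (k : ℝ) * (avoidingPerms B (r + 1)).card ≤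
        (k - B.card) * (avoidingPerms B r).card := by
      rw [← Nat.cast_sub hBk]
      exact_mod_cast h
    have h2 : ((avoidingPerms B (r + 1)).card : ℝ) ≤
        (1 - B.card / k) * (avoidingPerms B r).card := by
      refine le_of_mul_le_mul_left (h'.trans (le_of_eq ?_)) hk'
      field_simp
    refine h2.trans ((mul_le_mul_of_nonneg_left ih hx).trans (le_of_eq ?_))
    ring

/-! ### Selection of a query with a large error -/

theorem le_of_coe_le_add {s t r : ℝ} {x : WithTop ℝ}
    (h : ((s : ℝ) : WithTop ℝ) ≤ x + (t : ℝ)) (hr : r ≤ s - t) : ((r : ℝ) : WithTop ℝ) ≤ x := by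
  cases x with
  | top => simp
  | coe x =>
    rw [← WithTop.coe_add, WithTop.coe_le_coe] at h
    rw [WithTop.coe_le_coe]
    linarith

theorem coe_le_add_of_lt {s t r : ℝ} {x : WithTop ℝ} (h : ((r : ℝ) : WithTop ℝ) < x)
    (hr : s - t ≤ r) : ((s : ℝ) : WithTop ℝ) ≤ x + (t : ℝ) := by
  cases x with
  | top => simp
  | coe x =>
    rw [WithTop.coe_lt_coe] at h
    rw [← WithTop.coe_add, WithTop.coe_le_coe]
    linarith

/-- The union bound pays for `R` noises, not for all `k`; this is the gain from permuting. -/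
theorem prob_noise_gt_le {k : ℕ} {b₀ b : ℝ} (hb₀ : 0 < b₀) (hb : 0 < b) (t : ℝ) (R : ℕ) :
    ((lap b₀).prod (Measure.pi fun _ : Fin k => lap b))
        {n | t < |n.1| ∨ ∃ i : Fin k, (i : ℕ) < R ∧ t < |n.2 i|} ≤
      lap b₀ {x | t < |x|} + R * lap b {x | t < |x|} := by
  have := isProbabilityMeasure_lap hb₀
  have := isProbabilityMeasure_lap hb
  have hS : MeasurableSet {x : ℝ | t < |x|} := measurableSet_lt measurable_const measurable_id.abs
  set I : Finset (Fin k) := {i | (i : ℕ) < R} with hI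
  have hsub : {n : ℝ × (Fin k → ℝ) | t < |n.1| ∨ ∃ i : Fin k, (i : ℕ) < R ∧ t < |n.2 i|} ⊆
      ({x | t < |x|} ×ˢ Set.univ) ∪
        ⋃ i ∈ I, (Set.univ ×ˢ ((fun ν : Fin k → ℝ => ν i) ⁻¹' {x | t < |x|})) := by
    rintro n (hn | ⟨i, hi, hn⟩)
    · exact Or.inl ⟨hn, trivial⟩
    · refine Or.inr ?_
      simp only [Set.mem_iUnion]
      exact ⟨i, by simp [hI, hi], trivial, hn⟩
  refine (measure_mono hsub).trans ((measure_union_le _ _).trans (add_le_add ?_ ?_))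
  · simp [Measure.prod_prod]
  · refine (measure_biUnion_finset_le _ _).trans ?_
    have hi : ∀ i ∈ I, ((lap b₀).prod (Measure.pi fun _ : Fin k => lap b))
        (Set.univ ×ˢ ((fun ν : Fin k → ℝ => ν i) ⁻¹' {x | t < |x|})) = lap b {x | t < |x|} := by
      intro i _
      rw [Measure.prod_prod, measure_univ, one_mul]
      exact (measurePreserving_eval (fun _ : Fin k => lap b) i).measure_preimage
        hS.nullMeasurableSet
    rw [Finset.sum_congr rfl hi, Finset.sum_const, nsmul_eq_mul]
    gcongr
    calc I.card ≤ (Finset.range R).card :=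
          Finset.card_le_card_of_injOn (fun i => (i : ℕ))
            (fun i hi => by simpa [hI] using hi) fun i _ j _ h => Fin.ext h
      _ = R := Finset.card_range R

/-- If `ρ` and the first `R` noises are at most `w / 2`, then `i₀` passes its test. The search
therefore stops no later than `i₀`, at a position whose noise is also controlled. -/
theorem aboveThreshold_bad_le {k : ℕ} {η : ℝ} (hη : 0 < η) {T w : ℝ} {g : Fin k → WithTop ℝ}
    {R : ℕ} {i₀ : Fin k} (hi₀ : (i₀ : ℕ) < R) (hg : ((T + w : ℝ) : WithTop ℝ) < g i₀) :
    aboveThreshold η T g {o | ¬ ∃ i ∈ o, ((T - w : ℝ) : WithTop ℝ) ≤ g i} ≤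
      lap (2 / η) {x | w / 2 < |x|} + R * lap (4 / η) {x | w / 2 < |x|} := by
  rw [aboveThreshold_apply]
  refine (measure_mono ?_).trans (prob_noise_gt_le (by positivity) (by positivity) (w / 2) R)
  rintro ⟨ρ, ν⟩ hn
  by_contra hcon
  simp only [Set.mem_ofPred_eq, not_or, not_lt, not_exists, not_and] at hn hcon
  obtain ⟨hρ, hν⟩ := hcon
  have habove : ((T + ρ : ℝ) : WithTop ℝ) ≤ g i₀ + ((ν i₀ : ℝ) : WithTop ℝ) := by
    refine coe_le_add_of_lt hg ?_
    have := (abs_le.1 hρ).2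
    have := (abs_le.1 (hν i₀ hi₀)).1
    linarith
  cases ho : firstAbove T g ρ ν with
  | none => exact firstAbove_eq_none.1 ho i₀ habove
  | some i =>
    refine hn i ho ?_
    rw [firstAbove_eq_some] at ho
    have hi : (i : ℕ) < R := by
      by_contra hiR
      exact ho.2 i₀ (Fin.lt_def.2 (by omega)) habove
    refine le_of_coe_le_add ho.1 ?_
    have := (abs_le.1 hρ).1
    have := (abs_le.1 (hν i hi)).2
    linarith

theorem permutedAboveThreshold_bad_le {k : ℕ} (hk : 0 < k) {η : ℝ} (hη : 0 < η) {T w : ℝ}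
    {f : Fin k → WithTop ℝ} (R : ℕ) :
    permutedAboveThreshold η T f {o | ¬ ∃ i ∈ o, ((T - w : ℝ) : WithTop ℝ) ≤ f i} ≤
      lap (2 / η) {x | w / 2 < |x|} + R * lap (4 / η) {x | w / 2 < |x|} +
        ENNReal.ofReal
          ((1 - ({i | ((T + w : ℝ) : WithTop ℝ) < f i} : Set (Fin k)).ncard / k) ^ R) := by
  classical
  set B : Finset (Fin k) := {i | ((T + w : ℝ) : WithTop ℝ) < f i} with hB
  have hmem : ∀ i, ((T + w : ℝ) : WithTop ℝ) < f i ↔ i ∈ B := fun i => by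
    simp only [hB, Finset.mem_filter, Finset.mem_univ, true_and]
  have hcard : ({i | ((T + w : ℝ) : WithTop ℝ) < f i} : Set (Fin k)).ncard = B.card := by
    rw [← Set.ncard_coe_finset]
    congr 1
    ext i
    exact hmem i
  have hfac : ((k.factorial : ℕ) : ℝ≥0∞) ≠ 0 := by simpa using k.factorial_ne_zero
  set τ := lap (2 / η) {x | w / 2 < |x|} + R * lap (4 / η) {x | w / 2 < |x|}
  have hπ : ∀ π : Equiv.Perm (Fin k), aboveThreshold η T (fun i => f (π i))
      {o | Option.map π o ∈ {o | ¬ ∃ i ∈ o, ((T - w : ℝ) : WithTop ℝ) ≤ f i}} ≤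
        τ + if π ∈ avoidingPerms B R then 1 else 0 := by
    intro π
    by_cases hm : π ∈ avoidingPerms B R
    · rw [if_pos hm]
      have := isProbabilityMeasure_aboveThreshold hη T fun i => f (π i)
      exact prob_le_one.trans le_add_self
    · rw [if_neg hm, add_zero]
      rw [mem_avoidingPerms] at hm
      push Not at hm
      obtain ⟨i₀, hi₀, hi₀B⟩ := hm
      have hg : ((T + w : ℝ) : WithTop ℝ) < f (π i₀) := (hmem _).2 hi₀B
      refine (measure_mono ?_).trans (aboveThreshold_bad_le hη (g := fun i => f (π i)) hi₀ hg)
      intro o ho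
      simpa using ho
  rw [permutedAboveThreshold_apply, hcard]
  refine (mul_le_mul' le_rfl (Finset.sum_le_sum fun π _ => hπ π)).trans ?_
  rw [Finset.sum_add_distrib, Finset.sum_ite_mem, Finset.univ_inter, Finset.sum_const,
    Finset.sum_const, Finset.card_univ, Fintype.card_perm, Fintype.card_fin, nsmul_eq_mul,
    nsmul_eq_mul, mul_one, mul_add, ← mul_assoc, ENNReal.inv_mul_cancel hfac
    (ENNReal.natCast_ne_top _), one_mul]
  refine add_le_add le_rfl ?_
  rw [mul_comm, ← div_eq_mul_inv]
  refine ENNReal.div_le_of_le_mul ?_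
  have hBk : (B.card : ℝ) / k ≤ 1 := by
    rw [div_le_one (by positivity)]
    exact_mod_cast (by simpa using Finset.card_le_univ B : B.card ≤ k)
  rw [← ENNReal.ofReal_natCast, ← ENNReal.ofReal_natCast,
    ← ENNReal.ofReal_mul (pow_nonneg (by linarith) _)]
  exact ENNReal.ofReal_le_ofReal (card_avoidingPerms_le hk B R)

/-! ### The number of answers with a large error -/

/-- The number of queries whose answer has an error of more than `b`. -/
def largeCount {k : ℕ} (v : Fin k → ℝ) (b : ℝ) (a : Fin k → WithTop ℝ) : ℕ :=
  {i : Fin k | ((b : ℝ) : WithTop ℝ) < absErr (v i) (a i)}.ncard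

theorem measurable_largeCount {k : ℕ} (v : Fin k → ℝ) (b : ℝ) : Measurable (largeCount v b) := by
  classical
  have : largeCount v b = fun a => ∑ i, if ((b : ℝ) : WithTop ℝ) < absErr (v i) (a i) then 1
      else 0 := by
    ext a
    rw [← Finset.card_filter, largeCount, ← Set.ncard_coe_finset, Finset.coe_filter]
    simp only [Finset.mem_univ, true_and]
  rw [this]
  refine Finset.measurable_sum _ fun i _ => Measurable.ite ?_ measurable_const measurable_const
  exact ((measurable_absErr (v i)).comp (measurable_pi_apply i)) measurableSet_Ioi

theorem largeCount_le {k : ℕ} (v : Fin k → ℝ) (b : ℝ) (a : Fin k → WithTop ℝ) :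
    largeCount v b a ≤ k := by
  rw [largeCount]
  simpa using Set.ncard_le_card {i : Fin k | ((b : ℝ) : WithTop ℝ) < absErr (v i) (a i)}

theorem largeCount_anti {k : ℕ} (v : Fin k → ℝ) {b b' : ℝ} (h : b ≤ b') (a : Fin k → WithTop ℝ) :
    largeCount v b' a ≤ largeCount v b a :=
  Set.ncard_le_ncard (fun _ hi => lt_of_le_of_lt (WithTop.coe_le_coe.2 h) hi) (Set.toFinite _)

theorem largeCount_update_le_succ {k : ℕ} (v : Fin k → ℝ) (b : ℝ) (a : Fin k → WithTop ℝ)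
    (i : Fin k) (x : WithTop ℝ) :
    largeCount v b (Function.update a i x) ≤ largeCount v b a + 1 := by
  refine (Set.ncard_le_ncard (t := insert i _) ?_ (Set.toFinite _)).trans (Set.ncard_insert_le i _)
  intro j hj
  by_cases hji : j = i
  · exact Or.inl hji
  · exact Or.inr (by simpa [Function.update_of_ne hji] using hj)

theorem largeCount_update_le {k : ℕ} (v : Fin k → ℝ) {b : ℝ} (a : Fin k → WithTop ℝ)
    {i : Fin k} {z : ℝ} (hz : |z| ≤ b) :
    largeCount v b (Function.update a i ((v i + z : ℝ) : WithTop ℝ)) ≤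
      ({j : Fin k | ((b : ℝ) : WithTop ℝ) < absErr (v j) (a j)} \ {i}).ncard := by
  refine Set.ncard_le_ncard ?_ (Set.toFinite _)
  intro j hj
  by_cases hji : j = i
  · subst hji
    have hj : ((b : ℝ) : WithTop ℝ) < absErr (v j)
      (Function.update a j ((v j + z : ℝ) : WithTop ℝ) j) := hj
    rw [Function.update_self, absErr_coe, WithTop.coe_lt_coe, sub_add_cancel_left, abs_neg] at hj
    linarith
  · exact ⟨by simpa [Function.update_of_ne hji] using hj, hji⟩

/-- `exp x` as an extended nonnegative real. -/
def eexp (x : ℝ) : ℝ≥0∞ := ENNReal.ofReal (Real.exp x)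

theorem eexp_add (x y : ℝ) : eexp (x + y) = eexp x * eexp y := by
  rw [eexp, eexp, eexp, ← ENNReal.ofReal_mul (by positivity), ← Real.exp_add]

theorem eexp_mono {x y : ℝ} (h : x ≤ y) : eexp x ≤ eexp y :=
  ENNReal.ofReal_le_ofReal (Real.exp_le_exp.2 h)

theorem one_le_eexp {x : ℝ} (h : 0 ≤ x) : 1 ≤ eexp x := by
  rw [eexp, ENNReal.one_le_ofReal]
  exact Real.one_le_exp h

theorem measurable_eexp_natCast {Ω : Type*} [MeasurableSpace Ω] {N : Ω → ℕ} (hN : Measurable N) :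
    Measurable fun x => eexp (N x) :=
  (measurable_from_top (f := fun n : ℕ => eexp n)).comp hN

theorem lintegral_answerLaw_some_le {k : ℕ} (v : Fin k → ℝ) {ε : ℝ} (hε : 0 < ε) {b c : ℝ}
    (a : Fin k → WithTop ℝ) (i : Fin k)
    (h : ∀ z, |z| ≤ b → (largeCount v b (Function.update a i ((v i + z : ℝ) : WithTop ℝ)) : ℝ) ≤ c) :
    ∫⁻ x, eexp (largeCount v b x) ∂answerLaw v ε a (some i) ≤
      eexp c + lap (2 / ε) {z | b < |z|} * eexp (largeCount v b a + 1) := by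
  have := isProbabilityMeasure_lap (b := 2 / ε) (by positivity)
  have hS : MeasurableSet {x : ℝ | b < |x|} := measurableSet_lt measurable_const measurable_id.abs
  rw [answerLaw, lintegral_map (measurable_eexp_natCast (measurable_largeCount v b))
    (measurable_update_answer_right v a i)]
  calc _ ≤ ∫⁻ z, (eexp c + {x : ℝ | b < |x|}.indicator
        (fun _ => eexp (largeCount v b a + 1)) z) ∂lap (2 / ε) := by
        refine lintegral_mono fun z => ?_
        by_cases hz : b < |z|
        · rw [Set.indicator_of_mem (show z ∈ {x : ℝ | b < |x|} from hz)]
          refine le_trans (eexp_mono ?_) le_add_self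
          exact_mod_cast largeCount_update_le_succ v b a i _
        · exact le_add_right (eexp_mono (h z (not_lt.1 hz)))
    _ = _ := by
        rw [lintegral_add_left measurable_const, lintegral_indicator_const hS, lintegral_const,
          measure_univ, mul_one, mul_comm (eexp (_ + 1))]

theorem lintegral_answerLaw_le {k : ℕ} (v : Fin k → ℝ) {ε : ℝ} (hε : 0 < ε) (b : ℝ)
    (a : Fin k → WithTop ℝ) (o : Option (Fin k)) :
    ∫⁻ x, eexp (largeCount v b x) ∂answerLaw v ε a o ≤
      eexp (largeCount v b a) + lap (2 / ε) {z | b < |z|} * eexp (largeCount v b a + 1) := by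
  cases o with
  | none =>
    rw [answerLaw, lintegral_dirac' _ (measurable_eexp_natCast (measurable_largeCount v b))]
    exact le_self_add
  | some i =>
    refine lintegral_answerLaw_some_le v hε a i fun z hz => ?_
    exact_mod_cast (largeCount_update_le v a hz).trans
      (Set.ncard_le_ncard Set.sdiff_subset (Set.toFinite _))

theorem lintegral_answerLaw_le_succ {k : ℕ} (v : Fin k → ℝ) {ε : ℝ} (hε : 0 < ε) (b : ℝ)
    (a : Fin k → WithTop ℝ) (o : Option (Fin k)) :
    ∫⁻ x, eexp (largeCount v b x) ∂answerLaw v ε a o ≤ eexp (largeCount v b a + 1) := by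
  cases o with
  | none =>
    rw [answerLaw, lintegral_dirac' _ (measurable_eexp_natCast (measurable_largeCount v b))]
    exact eexp_mono (by linarith)
  | some i =>
    have := isProbabilityMeasure_lap (b := 2 / ε) (by positivity)
    rw [answerLaw, lintegral_map (measurable_eexp_natCast (measurable_largeCount v b))
      (measurable_update_answer_right v a i)]
    calc _ ≤ ∫⁻ _, eexp (largeCount v b a + 1) ∂lap (2 / ε) := by
          refine lintegral_mono fun z => eexp_mono ?_
          exact_mod_cast largeCount_update_le_succ v b a i _
      _ = _ := by simp

theorem lintegral_answerLaw_of_mem {k : ℕ} (v : Fin k → ℝ) {ε : ℝ} (hε : 0 < ε) {b : ℝ}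
    {a : Fin k → WithTop ℝ} {i : Fin k} (hi : ((b : ℝ) : WithTop ℝ) < absErr (v i) (a i)) :
    ∫⁻ x, eexp (largeCount v b x) ∂answerLaw v ε a (some i) ≤
      eexp (largeCount v b a - 1) + lap (2 / ε) {z | b < |z|} * eexp (largeCount v b a + 1) := by
  refine lintegral_answerLaw_some_le v hε a i fun z hz => ?_
  have h1 := largeCount_update_le v a (i := i) hz
  have h2 := Set.ncard_sdiff_singleton_add_one
    (s := {j : Fin k | ((b : ℝ) : WithTop ℝ) < absErr (v j) (a j)}) (a := i) hi (Set.toFinite _)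
  rw [le_sub_iff_add_le]
  exact_mod_cast (Nat.add_le_add_right h1 1).trans h2.le

theorem lintegral_correction_le {k : ℕ} (v : Fin k → ℝ) {ε : ℝ} (hε : 0 < ε) (T b : ℝ)
    (a : Fin k → WithTop ℝ) :
    ∫⁻ x, eexp (largeCount v b x) ∂correction v ε T a ≤
      eexp (largeCount v b a) + lap (2 / ε) {z | b < |z|} * eexp (largeCount v b a + 1) := by
  have := isProbabilityMeasure_permutedAboveThreshold (η := 0.5 * ε) (by positivity) T
    fun i => absErr (v i) (a i)
  rw [lintegral_correction _ _ _ _ (measurable_eexp_natCast (measurable_largeCount v b))]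
  refine (lintegral_mono fun o => lintegral_answerLaw_le v hε b a o).trans ?_
  simp

/-- An accurate answer at an index that is counted lowers the count by one. An inaccurate answer or
a bad selection raises it by at most one, and both are charged at that rate. -/
theorem lintegral_correction_le_of_select {k : ℕ} (v : Fin k → ℝ) {ε : ℝ} (hε : 0 < ε) (T b : ℝ)
    (a : Fin k → WithTop ℝ) :
    ∫⁻ x, eexp (largeCount v b x) ∂correction v ε T a ≤
      eexp (largeCount v b a - 1) + (lap (2 / ε) {z | b < |z|} +
        permutedAboveThreshold (0.5 * ε) T (fun i => absErr (v i) (a i))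
          {o | ¬ ∃ i ∈ o, ((b : ℝ) : WithTop ℝ) < absErr (v i) (a i)}) *
            eexp (largeCount v b a + 1) := by
  have := isProbabilityMeasure_permutedAboveThreshold (η := 0.5 * ε) (by positivity) T
    fun i => absErr (v i) (a i)
  rw [lintegral_correction _ _ _ _ (measurable_eexp_natCast (measurable_largeCount v b))]
  set S : Set (Option (Fin k)) := {o | ¬ ∃ i ∈ o, ((b : ℝ) : WithTop ℝ) < absErr (v i) (a i)}
  set c := eexp (largeCount v b a - 1) + lap (2 / ε) {z | b < |z|} * eexp (largeCount v b a + 1)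
  calc _ ≤ ∫⁻ o, (c + S.indicator (fun _ => eexp (largeCount v b a + 1)) o)
        ∂permutedAboveThreshold (0.5 * ε) T (fun i => absErr (v i) (a i)) := by
        refine lintegral_mono fun o => ?_
        by_cases ho : o ∈ S
        · rw [Set.indicator_of_mem ho]
          exact (lintegral_answerLaw_le_succ v hε b a o).trans le_add_self
        · obtain ⟨i, rfl, hi⟩ := not_not.1 ho
          exact le_add_right (lintegral_answerLaw_of_mem v hε hi)
    _ = _ := by
        rw [lintegral_add_left measurable_const,
          lintegral_indicator_const (show MeasurableSet S from trivial), lintegral_const,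
          measure_univ, mul_one, add_mul, add_assoc, mul_comm (eexp (_ + 1))]

/-! ### Iterating a kernel -/

/-- The probability that a chain with the kernel `K` is in `S` after `t` steps. -/
def hitProb {Ω : Type*} [MeasurableSpace Ω] (K : Ω → Measure Ω) (S : Set Ω) : ℕ → Ω → ℝ≥0∞
  | 0 => S.indicator fun _ => 1
  | t + 1 => fun a => ∫⁻ x, hitProb K S t x ∂K a

theorem measurable_hitProb {Ω : Type*} [MeasurableSpace Ω] {K : Ω → Measure Ω}
    (hK : Measurable K) {S : Set Ω} (hS : MeasurableSet S) (t : ℕ) :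
    Measurable (hitProb K S t) := by
  induction t with
  | zero => exact measurable_const.indicator hS
  | succ t ih => exact (Measure.measurable_lintegral ih).comp hK

theorem iterate_bind_apply {Ω : Type*} [MeasurableSpace Ω] {K : Ω → Measure Ω}
    (hK : Measurable K) {S : Set Ω} (hS : MeasurableSet S) (t : ℕ) (μ : Measure Ω) :
    ((fun μ : Measure Ω => μ.bind K)^[t] μ) S = ∫⁻ a, hitProb K S t a ∂μ := by
  induction t generalizing μ with
  | zero => simp [hitProb, lintegral_indicator_const hS]
  | succ t ih =>
    rw [Function.iterate_succ_apply, ih, Measure.lintegral_bind hK.aemeasurable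
      (measurable_hitProb hK hS t).aemeasurable]
    rfl

theorem hitProb_le_one {Ω : Type*} [MeasurableSpace Ω] {K : Ω → Measure Ω}
    (hK : ∀ a, IsProbabilityMeasure (K a)) (S : Set Ω) (t : ℕ) (a : Ω) : hitProb K S t a ≤ 1 := by
  induction t generalizing a with
  | zero => exact Set.indicator_le_self' (fun _ _ => zero_le_one) a
  | succ t ih => exact (lintegral_mono ih).trans (by simp)

theorem isProbabilityMeasure_iterate_bind {Ω : Type*} [MeasurableSpace Ω] {K : Ω → Measure Ω}
    (hK : Measurable K) (hK' : ∀ a, IsProbabilityMeasure (K a)) (t : ℕ) (μ : Measure Ω)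
    [IsProbabilityMeasure μ] : IsProbabilityMeasure ((fun μ : Measure Ω => μ.bind K)^[t] μ) := by
  induction t with
  | zero => assumption
  | succ t ih =>
    rw [Function.iterate_succ_apply']
    constructor
    rw [Measure.bind_apply MeasurableSet.univ hK.aemeasurable]
    simp

/-- Markov's inequality for the exponential moment: `exp (B - n')` dominates the indicator, and each
step multiplies its mean by at most `exp q`. -/
theorem hitProb_le_of_drift {Ω : Type*} [MeasurableSpace Ω] {K : Ω → Measure Ω}
    {B : Ω → ℕ} (hB : Measurable B) {q n' : ℝ}
    (h : ∀ a, ∫⁻ x, eexp (B x) ∂K a ≤ eexp q * eexp (B a)) (t : ℕ) (a : Ω) :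
    hitProb K {x | n' < B x} t a ≤ eexp (B a - n' + t * q) := by
  induction t generalizing a with
  | zero =>
    by_cases ha : n' < B a
    · rw [hitProb, Set.indicator_of_mem (show a ∈ {x | n' < (B x : ℝ)} from ha)]
      exact one_le_eexp (by simp; linarith)
    · rw [hitProb, Set.indicator_of_notMem (show a ∉ {x | n' < (B x : ℝ)} from ha)]
      exact zero_le
  | succ t ih =>
    calc hitProb K {x | n' < B x} (t + 1) a ≤ ∫⁻ x, eexp (-n' + t * q) * eexp (B x) ∂K a := by
          refine lintegral_mono fun x => (ih x).trans_eq ?_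
          rw [← eexp_add]
          congr 1
          ring
      _ ≤ eexp (-n' + t * q) * (eexp q * eexp (B a)) := by
          rw [lintegral_const_mul _ (measurable_eexp_natCast hB)]
          exact mul_le_mul' le_rfl (h a)
      _ = _ := by
          rw [← eexp_add, ← eexp_add]
          congr 1
          push_cast
          ring

/-- If `B` drops to `s` at some time, the upward drift alone bounds a later return above `n'`. If it
never does, then `N ≥ B > s` throughout although `exp N` has shrunk by `exp (-r)` in mean at every
step. Induction on the first step replaces a stopping time. -/
theorem hitProb_le_of_two_drifts {Ω : Type*} [MeasurableSpace Ω] {K : Ω → Measure Ω}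
    (hK : ∀ a, IsProbabilityMeasure (K a))
    {B N : Ω → ℕ} (hB : Measurable B) (hN : Measurable N) (hBN : ∀ a, B a ≤ N a) {q r s n' : ℝ}
    (hq : 0 ≤ q) (h : ∀ a, ∫⁻ x, eexp (B x) ∂K a ≤ eexp q * eexp (B a))
    (h' : ∀ a, s < B a → ∫⁻ x, eexp (N x) ∂K a ≤ eexp (-r) * eexp (N a)) (t : ℕ) (a : Ω) :
    hitProb K {x | n' < B x} t a ≤ eexp (s - n' + t * q) + eexp (N a - s - t * r) := by
  by_cases ha : s < B a
  · induction t generalizing a with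
    | zero =>
      refine (hitProb_le_one hK _ 0 a).trans (le_add_left (one_le_eexp ?_))
      have : (B a : ℝ) ≤ N a := by exact_mod_cast hBN a
      simp
      linarith
    | succ t ih =>
      have ih' : ∀ x, hitProb K {x | n' < B x} t x ≤
          eexp (s - n' + t * q) + eexp (-s - t * r) * eexp (N x) := by
        intro x
        rw [← eexp_add, show -s - t * r + (N x : ℝ) = N x - s - t * r by ring]
        by_cases hx : s < B x
        · exact ih x hx
        · exact (hitProb_le_of_drift hB h t x).trans
            (le_add_right (eexp_mono (by linarith [not_lt.1 hx])))
      calc hitProb K {x | n' < B x} (t + 1) a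
          ≤ ∫⁻ x, (eexp (s - n' + t * q) + eexp (-s - t * r) * eexp (N x)) ∂K a :=
            lintegral_mono ih'
        _ = eexp (s - n' + t * q) + eexp (-s - t * r) * ∫⁻ x, eexp (N x) ∂K a := by
            rw [lintegral_add_left measurable_const,
              lintegral_const_mul _ (measurable_eexp_natCast hN)]
            simp
        _ ≤ _ := by
            refine add_le_add (eexp_mono ?_) ?_
            · push_cast
              linarith
            · refine (mul_le_mul' le_rfl (h' a ha)).trans (le_of_eq ?_)
              rw [← eexp_add, ← eexp_add]
              congr 1
              push_cast
              ring
  · exact (hitProb_le_of_drift hB h t a).trans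
      (le_add_right (eexp_mono (by linarith [not_lt.1 ha])))

theorem iterate_bind_apply_le {Ω : Type*} [MeasurableSpace Ω] {K : Ω → Measure Ω}
    (hK : Measurable K) (hK' : ∀ a, IsProbabilityMeasure (K a))
    {B N : Ω → ℕ} (hB : Measurable B) (hN : Measurable N) (hBN : ∀ a, B a ≤ N a)
    {q r s n n' : ℝ} (hq : 0 ≤ q) (h : ∀ a, ∫⁻ x, eexp (B x) ∂K a ≤ eexp q * eexp (B a))
    (h' : ∀ a, s < B a → ∫⁻ x, eexp (N x) ∂K a ≤ eexp (-r) * eexp (N a)) (t : ℕ)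
    (μ : Measure Ω) [IsProbabilityMeasure μ] :
    ((fun μ : Measure Ω => μ.bind K)^[t] μ) {x | n' < B x} ≤
      μ {x | n < N x} + (eexp (s - n' + t * q) + eexp (n - s - t * r)) := by
  have hS : ∀ (M : Ω → ℕ) (c : ℝ), Measurable M → MeasurableSet {x | c < (M x : ℝ)} :=
    fun M c hM => measurableSet_lt measurable_const (measurable_from_top.comp hM)
  rw [iterate_bind_apply hK (hS B n' hB)]
  calc _ ≤ ∫⁻ a, ({x | n < (N x : ℝ)}.indicator (fun _ => 1) a +
        (eexp (s - n' + t * q) + eexp (n - s - t * r))) ∂μ := by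
        refine lintegral_mono fun a => ?_
        by_cases ha : n < N a
        · rw [Set.indicator_of_mem (show a ∈ {x | n < (N x : ℝ)} from ha)]
          exact (hitProb_le_one hK' _ t a).trans le_self_add
        · refine ((hitProb_le_of_two_drifts hK' hB hN hBN hq h h' t a).trans
            (add_le_add le_rfl (eexp_mono ?_))).trans le_add_self
          linarith [not_lt.1 ha]
    _ = _ := by
        rw [lintegral_add_right _ measurable_const, lintegral_indicator_const (hS N n hN)]
        simp

/-! ### One stage of the algorithm -/

/-- The error that an answer may have after stage `l`. -/
def radius (k : ℕ) (ε δ : ℝ) (l : ℕ) : ℝ :=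
  4 * (∑ j ∈ Finset.Ico 1 (l + 1), width k ε δ j) + 2 * width k ε δ (l + 1)

theorem width_eq {k : ℕ} (hk : 0 < k) (ε δ : ℝ) (l : ℕ) :
    width k ε δ l = 100 * Real.log (500 / kappa ^ l) / epsStage k ε δ l := by
  have := kappa_pos
  rw [width, mReal]
  congr 3
  field_simp

theorem kappa_pow_le_one (l : ℕ) : kappa ^ l ≤ 1 :=
  pow_le_one₀ kappa_pos.le (by norm_num [kappa])

theorem log_div_kappa_pow_pos (l : ℕ) : 0 < Real.log (500 / kappa ^ l) := by
  have h0 : 0 < kappa ^ l := pow_pos kappa_pos l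
  refine Real.log_pos ?_
  rw [lt_div_iff₀ h0]
  linarith [kappa_pow_le_one l]

theorem width_pos {k : ℕ} (hk : 0 < k) {ε δ : ℝ} (hε : 0 < ε) (hδ : 0 < δ) (hδ' : δ ≤ 0.5)
    {l : ℕ} (hl : 0 < l) : 0 < width k ε δ l := by
  have := epsStage_pos hk hε hδ hδ' hl
  have := log_div_kappa_pow_pos l
  rw [width_eq hk]
  positivity

/-- This explains the form of the threshold. Selection is accurate up to one width, so errors above
`T + w`, the new radius, are found, while whatever is selected has error at least `T - w`, which
exceeds the old radius. -/
theorem threshold_add_width (k : ℕ) (ε δ : ℝ) (l : ℕ) :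
    threshold k ε δ (l + 1) + width k ε δ (l + 1) = radius k ε δ (l + 1) := by
  rw [threshold, radius, Finset.sum_Ico_succ_top (by omega : 1 ≤ l + 1)]
  ring

theorem radius_lt_threshold_sub_width {k : ℕ} (hk : 0 < k) {ε δ : ℝ} (hε : 0 < ε) (hδ : 0 < δ)
    (hδ' : δ ≤ 0.5) (l : ℕ) :
    radius k ε δ l < threshold k ε δ (l + 1) - width k ε δ (l + 1) := by
  have := width_pos hk hε hδ hδ' (l + 1).succ_pos
  rw [threshold, radius]
  simp only [Nat.succ_eq_add_one] at this
  linarith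

theorem width_le_radius {k : ℕ} (hk : 0 < k) {ε δ : ℝ} (hε : 0 < ε) (hδ : 0 < δ)
    (hδ' : δ ≤ 0.5) (l : ℕ) : width k ε δ (l + 1) ≤ radius k ε δ l := by
  have h1 := width_pos hk hε hδ hδ' l.succ_pos
  have h2 : 0 ≤ ∑ j ∈ Finset.Ico 1 (l + 1), width k ε δ j := Finset.sum_nonneg fun j hj =>
    (width_pos hk hε hδ hδ' (Finset.mem_Ico.1 hj).1).le
  rw [radius]
  simp only [Nat.succ_eq_add_one] at h1
  linarith

theorem radius_le_radius_succ {k : ℕ} (hk : 0 < k) {ε δ : ℝ} (hε : 0 < ε) (hδ : 0 < δ)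
    (hδ' : δ ≤ 0.5) (l : ℕ) : radius k ε δ l ≤ radius k ε δ (l + 1) := by
  have h1 := width_pos hk hε hδ hδ' l.succ_pos
  have h2 := radius_lt_threshold_sub_width hk hε hδ hδ' l
  rw [← threshold_add_width]
  simp only [Nat.succ_eq_add_one] at h1
  linarith

/-- The third power leaves room for a union bound over about `10 / x` noises, as in
`tail_mul_ceil_le`. -/
theorem lap_tail_le {b t x : ℝ} (hb : 0 < b) (hx : 0 < x)
    (h : 3 * Real.log (500 / x) * (2 * b) ≤ t) :
    lap b {y | t < |y|} ≤ ENNReal.ofReal (2 * (x / 500) ^ 3) := by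
  refine (lap_abs_gt_le hb t).trans (ENNReal.ofReal_le_ofReal ?_)
  have h1 : (x / 500) ^ 3 = Real.exp (-(3 * Real.log (500 / x))) := by
    rw [← inv_div, inv_pow, Real.exp_neg, mul_comm, Real.exp_mul, Real.exp_log (by positivity)]
    norm_num
  rw [h1]
  gcongr
  rw [neg_div, neg_le_neg_iff, le_div_iff₀ (by positivity)]
  exact h

theorem lap_answer_tail_le {k : ℕ} (hk : 0 < k) {ε δ : ℝ} (hε : 0 < ε) (hδ : 0 < δ)
    (hδ' : δ ≤ 0.5) {l : ℕ} {t : ℝ} (ht : width k ε δ (l + 1) ≤ t) :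
    lap (2 / epsStage k ε δ (l + 1)) {z | t < |z|} ≤ ENNReal.ofReal 0.001 := by
  have he := epsStage_pos hk hε hδ hδ' l.succ_pos
  simp only [Nat.succ_eq_add_one] at he
  have hx := pow_pos kappa_pos (l + 1)
  refine (lap_tail_le (by positivity) hx ?_).trans (ENNReal.ofReal_le_ofReal ?_)
  · refine le_trans ?_ ht
    have := log_div_kappa_pow_pos (l + 1)
    rw [width_eq hk, show 3 * Real.log (500 / kappa ^ (l + 1)) * (2 * (2 / epsStage k ε δ (l + 1)))
      = 12 * Real.log (500 / kappa ^ (l + 1)) / epsStage k ε δ (l + 1) by ring]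
    gcongr
    norm_num
  · have := pow_le_pow_left₀ (by positivity) (div_le_div_of_nonneg_right
      (kappa_pow_le_one (l + 1)) (by norm_num : (0 : ℝ) ≤ 500)) 3
    norm_num at this ⊢
    linarith

theorem exp_neg_five_le : Real.exp (-5) ≤ 0.007 := by
  have h1 : (2.7 : ℝ) ^ 5 ≤ Real.exp 5 := by
    have : Real.exp 5 = Real.exp 1 ^ 5 := by rw [← Real.exp_nat_mul]; norm_num
    rw [this]
    exact pow_le_pow_left₀ (by norm_num) (by linarith [Real.exp_one_gt_d9]) 5
  rw [Real.exp_neg]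
  refine inv_le_of_inv_le₀ (by norm_num) (le_trans ?_ h1)
  norm_num

theorem one_sub_pow_le {x y : ℝ} (hx : 0 < x) (hy : x / 2 ≤ y) (hy1 : y ≤ 1) :
    (1 - y) ^ ⌈10 / x⌉₊ ≤ 0.007 := by
  have h1 : 10 / x ≤ ⌈10 / x⌉₊ := Nat.le_ceil _
  have h2 : 5 ≤ (⌈10 / x⌉₊ : ℝ) * y := by
    calc (5 : ℝ) = 10 / x * (x / 2) := by field_simp; norm_num
      _ ≤ _ := by gcongr
  calc (1 - y) ^ ⌈10 / x⌉₊ ≤ Real.exp (-y) ^ ⌈10 / x⌉₊ :=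
        pow_le_pow_left₀ (by linarith) (Real.one_sub_le_exp_neg y) _
    _ = Real.exp (-(⌈10 / x⌉₊ * y)) := by rw [← Real.exp_nat_mul, mul_neg]
    _ ≤ Real.exp (-5) := Real.exp_le_exp.2 (by linarith)
    _ ≤ _ := exp_neg_five_le

theorem tail_mul_ceil_le {x : ℝ} (hx : 0 < x) (hx1 : x ≤ 1) :
    2 * (x / 500) ^ 3 + ⌈10 / x⌉₊ * (2 * (x / 500) ^ 3) ≤ 0.001 := by
  have h1 : (⌈10 / x⌉₊ : ℝ) ≤ 10 / x + 1 := (Nat.ceil_lt_add_one (by positivity)).le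
  calc _ ≤ 2 * (x / 500) ^ 3 + (10 / x + 1) * (2 * (x / 500) ^ 3) := by gcongr
    _ = (20 * x ^ 2 + 4 * x ^ 3) / 500 ^ 3 := by field_simp; ring
    _ ≤ (20 * 1 ^ 2 + 4 * 1 ^ 3) / 500 ^ 3 := by gcongr
    _ ≤ _ := by norm_num

theorem prob_select_small_le {k : ℕ} (hk : 0 < k) {ε δ : ℝ} (hε : 0 < ε) (hδ : 0 < δ)
    (hδ' : δ ≤ 0.5) (v : Fin k → ℝ) (l : ℕ) (a : Fin k → WithTop ℝ)
    (ha : kappa ^ l * k / 2 < largeCount v (radius k ε δ (l + 1)) a) :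
    permutedAboveThreshold (0.5 * epsStage k ε δ (l + 1)) (threshold k ε δ (l + 1))
        (fun i => absErr (v i) (a i))
        {o | ¬ ∃ i ∈ o, ((radius k ε δ l : ℝ) : WithTop ℝ) < absErr (v i) (a i)} ≤
      ENNReal.ofReal 0.01 := by
  have he := epsStage_pos hk hε hδ hδ' l.succ_pos
  simp only [Nat.succ_eq_add_one] at he
  have hx := pow_pos kappa_pos (l + 1)
  have hx1 := kappa_pow_le_one (l + 1)
  have hlog := log_div_kappa_pow_pos (l + 1)
  have hR := radius_lt_threshold_sub_width hk hε hδ hδ' l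
  have hsum := tail_mul_ceil_le hx hx1
  have hkx : kappa ^ (l + 1) ≤ kappa ^ l :=
    pow_le_pow_of_le_one kappa_pos.le (by norm_num [kappa]) (Nat.le_succ l)
  have hN := largeCount_le v (radius k ε δ (l + 1)) a
  have hy1 : (largeCount v (radius k ε δ (l + 1)) a : ℝ) / k ≤ 1 := by
    rw [div_le_one (by positivity)]
    exact_mod_cast hN
  have hy : kappa ^ (l + 1) / 2 ≤ largeCount v (radius k ε δ (l + 1)) a / k := by
    rw [le_div_iff₀ (by positivity)]
    have : kappa ^ (l + 1) * (k : ℝ) ≤ kappa ^ l * k := by gcongr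
    linarith
  -- At least the fraction `x / 2` of the queries is large, so `⌈10 / x⌉₊` positions miss them all
  -- with probability at most `exp (-5)`.
  have hpow := one_sub_pow_le hx hy hy1
  set e := epsStage k ε δ (l + 1) with he'
  set x := kappa ^ (l + 1) with hx'
  set w := width k ε δ (l + 1) with hw'
  have hw : w = 100 * Real.log (500 / x) / e := width_eq hk ε δ (l + 1)
  have ht₀ : lap (2 / (0.5 * e)) {y | w / 2 < |y|} ≤ ENNReal.ofReal (2 * (x / 500) ^ 3) := by
    refine lap_tail_le (by positivity) hx ?_
    rw [hw, show 3 * Real.log (500 / x) * (2 * (2 / (0.5 * e))) = 24 * Real.log (500 / x) / e by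
      field_simp; norm_num, show 100 * Real.log (500 / x) / e / 2 = 50 * Real.log (500 / x) / e by
      ring]
    gcongr
    norm_num
  have ht : lap (4 / (0.5 * e)) {y | w / 2 < |y|} ≤ ENNReal.ofReal (2 * (x / 500) ^ 3) := by
    refine lap_tail_le (by positivity) hx ?_
    rw [hw, show 3 * Real.log (500 / x) * (2 * (4 / (0.5 * e))) = 48 * Real.log (500 / x) / e by
      field_simp; norm_num, show 100 * Real.log (500 / x) / e / 2 = 50 * Real.log (500 / x) / e by
      ring]
    gcongr
    norm_num
  have hmain := permutedAboveThreshold_bad_le hk (η := 0.5 * e) (by positivity)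
    (T := threshold k ε δ (l + 1)) (w := w) (f := fun i => absErr (v i) (a i)) ⌈10 / x⌉₊
  rw [threshold_add_width] at hmain
  refine (measure_mono ?_).trans (hmain.trans ?_)
  · intro o ho ⟨i, hi, hle⟩
    exact ho ⟨i, hi, lt_of_lt_of_le (WithTop.coe_lt_coe.2 hR) hle⟩
  · refine (add_le_add (add_le_add ht₀ (mul_le_mul' le_rfl ht))
      (ENNReal.ofReal_le_ofReal hpow)).trans ?_
    rw [← ENNReal.ofReal_natCast, ← ENNReal.ofReal_mul (by positivity),
      ← ENNReal.ofReal_add (by positivity) (by positivity),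
      ← ENNReal.ofReal_add (by positivity) (by norm_num)]
    refine ENNReal.ofReal_le_ofReal ?_
    norm_num at hsum ⊢
    linarith

theorem one_add_mul_eexp_le : 1 + ENNReal.ofReal 0.001 * eexp 1 ≤ eexp 0.06 := by
  rw [eexp, eexp, ← ENNReal.ofReal_mul (by norm_num), ← ENNReal.ofReal_one,
    ← ENNReal.ofReal_add (by norm_num) (by positivity)]
  refine ENNReal.ofReal_le_ofReal ?_
  have := Real.exp_one_lt_d9
  have := Real.add_one_le_exp (0.06 : ℝ)
  norm_num at *
  linarith

theorem eexp_add_mul_eexp_le :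
    eexp (-1) + (ENNReal.ofReal 0.001 + ENNReal.ofReal 0.01) * eexp 1 ≤ eexp (-0.8) := by
  rw [eexp, eexp, eexp, ← ENNReal.ofReal_add (by norm_num) (by norm_num),
    ← ENNReal.ofReal_mul (by norm_num), ← ENNReal.ofReal_add (by positivity) (by positivity)]
  refine ENNReal.ofReal_le_ofReal ?_
  have h1 := Real.exp_one_lt_d9
  have h2 := Real.add_one_le_exp (0.2 : ℝ)
  have h3 : Real.exp (-0.8) = Real.exp (-1) * Real.exp 0.2 := by
    rw [← Real.exp_add]
    norm_num
  have h4 : Real.exp 1 = Real.exp (-1) * Real.exp 1 ^ 2 := by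
    rw [← Real.exp_nat_mul, ← Real.exp_add]
    norm_num
  have h5 : Real.exp 1 ^ 2 ≤ 3 ^ 2 := pow_le_pow_left₀ (by positivity) (by linarith) 2
  have h6 := Real.exp_pos (-1)
  rw [h3]
  nlinarith

theorem eexp_le_three : eexp 0.8 ≤ 3 := by
  rw [eexp, show (3 : ℝ≥0∞) = ENNReal.ofReal 3 by norm_num]
  refine ENNReal.ofReal_le_ofReal ?_
  have := Real.exp_one_lt_d9
  have : Real.exp 0.8 ≤ Real.exp 1 := Real.exp_le_exp.2 (by norm_num)
  linarith

/-- With `m = κ^l k`, the two-drift bound is used with `n = m`, `s = m / 2`, `n' = 0.9 m` and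
between `0.9 m - 1` and `0.9 m` steps. The exponents are at most `-0.346 m` and `-0.22 m + 0.8`; the
`0.8` comes from the floor and costs the factor 3 in `4 = 1 + 3`. -/
theorem stage_failure_le {k : ℕ} (hk : 0 < k) {ε δ : ℝ} (hε : 0 < ε) (hδ : 0 < δ)
    (hδ' : δ ≤ 0.5) (v : Fin k → ℝ) (l : ℕ) (μ : Measure (Fin k → WithTop ℝ))
    [IsProbabilityMeasure μ] :
    ((fun μ : Measure _ => μ.bind (correction v (epsStage k ε δ (l + 1))
        (threshold k ε δ (l + 1))))^[mCount k (l + 1)] μ)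
        {a | kappa ^ (l + 1) * k < largeCount v (radius k ε δ (l + 1)) a} ≤
      μ {a | kappa ^ l * k < largeCount v (radius k ε δ l) a} +
        4 * eexp (-(0.2 * (kappa ^ l * k))) := by
  have he := epsStage_pos hk hε hδ hδ' l.succ_pos
  simp only [Nat.succ_eq_add_one] at he
  have hRl := width_le_radius hk hε hδ hδ' l
  have hRR := radius_le_radius_succ hk hε hδ hδ' l
  have hm0 : 0 ≤ kappa ^ l * k := mul_nonneg (pow_nonneg kappa_pos.le l) (Nat.cast_nonneg k)
  have hM : mReal k (l + 1) = 0.9 * (kappa ^ l * k) := by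
    rw [mReal, pow_succ', show kappa = 0.9 from rfl]
    ring
  have ht : (mCount k (l + 1) : ℝ) ≤ 0.9 * (kappa ^ l * k) := by
    rw [mCount, hM]
    exact Nat.floor_le (by positivity)
  have ht' : 0.9 * (kappa ^ l * k) - 1 ≤ mCount k (l + 1) := by
    rw [mCount, hM]
    linarith [Nat.lt_floor_add_one (0.9 * (kappa ^ l * (k : ℝ)))]
  have hκ : kappa ^ (l + 1) * k = 0.9 * (kappa ^ l * k) := hM
  refine (iterate_bind_apply_le (measurable_correction v _ _)
    (isProbabilityMeasure_correction v he _) (measurable_largeCount v _)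
    (measurable_largeCount v (radius k ε δ l)) (largeCount_anti v hRR)
    (q := 0.06) (r := 0.8) (s := kappa ^ l * k / 2) (n := kappa ^ l * k) (by norm_num)
    (fun a => ?_) (fun a ha => ?_) (mCount k (l + 1)) μ).trans (add_le_add le_rfl ?_)
  · refine (lintegral_correction_le v he _ _ a).trans ?_
    rw [add_comm (largeCount v _ a : ℝ) 1, eexp_add, ← mul_assoc]
    nth_rewrite 1 [← one_mul (eexp (largeCount v _ a))]
    rw [← add_mul]
    refine mul_le_mul' (le_trans (add_le_add le_rfl (mul_le_mul' ?_ le_rfl))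
      one_add_mul_eexp_le) le_rfl
    exact lap_answer_tail_le hk hε hδ hδ' (hRl.trans hRR)
  · refine (lintegral_correction_le_of_select v he _ _ a).trans ?_
    rw [add_comm (largeCount v _ a : ℝ) 1, eexp_add, sub_eq_neg_add, eexp_add, ← mul_assoc,
      ← add_mul]
    refine mul_le_mul' (le_trans (add_le_add le_rfl (mul_le_mul' (add_le_add ?_ ?_) le_rfl))
      eexp_add_mul_eexp_le) le_rfl
    · exact lap_answer_tail_le hk hε hδ hδ' hRl
    · exact prob_select_small_le hk hε hδ hδ' v l a ha
  · have h1 : eexp (kappa ^ l * k / 2 - kappa ^ (l + 1) * k + mCount k (l + 1) * 0.06) ≤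
        eexp (-(0.2 * (kappa ^ l * k))) := by
      refine eexp_mono ?_
      rw [hκ]
      norm_num at *
      linarith
    have h2 : eexp (kappa ^ l * k - kappa ^ l * k / 2 - mCount k (l + 1) * 0.8) ≤
        3 * eexp (-(0.2 * (kappa ^ l * k))) := by
      refine le_trans (eexp_mono (y := 0.8 + -(0.2 * (kappa ^ l * k))) ?_) ?_
      · norm_num at *
        linarith
      · rw [eexp_add]
        exact mul_le_mul' eexp_le_three le_rfl
    refine (add_le_add h1 h2).trans (le_of_eq ?_)
    rw [show (4 : ℝ≥0∞) = 1 + 3 by norm_num, add_mul, one_mul]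

theorem isProbabilityMeasure_iterativeSV {k : ℕ} (v : Fin k → ℝ) {ε : ℕ → ℝ}
    (hε : ∀ l, 0 < ε (l + 1)) (m : ℕ → ℕ) (T : ℕ → ℝ) (L : ℕ) :
    IsProbabilityMeasure (iterativeSV v ε m T L) := by
  induction L with
  | zero =>
    rw [iterativeSV]
    infer_instance
  | succ l ih =>
    rw [iterativeSV]
    exact isProbabilityMeasure_iterate_bind (measurable_correction v _ _)
      (isProbabilityMeasure_correction v (hε l) _) _ _

theorem iterativeSV_failure_le {k : ℕ} (hk : 0 < k) {ε δ : ℝ} (hε : 0 < ε) (hδ : 0 < δ)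
    (hδ' : δ ≤ 0.5) (v : Fin k → ℝ) (L : ℕ) :
    iterativeSV v (epsStage k ε δ) (mCount k) (threshold k ε δ) L
        {a | kappa ^ L * k < largeCount v (radius k ε δ L) a} ≤
      ∑ l ∈ Finset.range L, 4 * eexp (-(0.2 * (kappa ^ l * k))) := by
  induction L with
  | zero =>
    -- Before the first stage the invariant only says that at most `k` answers are wrong.
    have : {a | kappa ^ 0 * (k : ℝ) < largeCount v (radius k ε δ 0) a} = ∅ := by
      refine Set.eq_empty_of_forall_notMem fun a ha => ?_
      have ha : kappa ^ 0 * (k : ℝ) < largeCount v (radius k ε δ 0) a := ha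
      rw [pow_zero, one_mul, Nat.cast_lt] at ha
      exact absurd ha (not_lt.2 (largeCount_le v _ a))
    rw [this]
    simp
  | succ l ih =>
    have := isProbabilityMeasure_iterativeSV v
      (fun l => epsStage_pos hk hε hδ hδ' l.succ_pos) (mCount k) (threshold k ε δ) l
    rw [Finset.sum_range_succ]
    exact (stage_failure_le hk hε hδ hδ' v l _).trans (add_le_add ih le_rfl)

/-! ### The number of stages and the final error -/

theorem one_div_kappa_rpow {y : ℝ} (hy : 0 < y) :
    (1 / kappa) ^ (10 * Real.logb (1 / kappa) y) = y ^ 10 := by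
  have h1 : 0 < 1 / kappa := one_div_pos.2 kappa_pos
  rw [mul_comm, Real.rpow_mul h1.le, Real.rpow_logb h1 (by norm_num [kappa]) hy]
  exact_mod_cast Real.rpow_natCast y 10

theorem kappa_pow_numStages_le {k : ℕ} (hk : 0 < Real.log k) :
    kappa ^ numStages k ≤ 1 / Real.log k ^ 10 := by
  have hκ := kappa_pos
  have h1 : Real.log k ^ 10 ≤ (1 / kappa) ^ numStages k := by
    rw [← one_div_kappa_rpow hk, ← Real.rpow_natCast]
    exact Real.rpow_le_rpow_of_exponent_le (by norm_num [kappa]) (Nat.le_ceil _)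
  rw [one_div_pow] at h1
  rw [le_one_div (by positivity) (by positivity)]
  exact h1

theorem le_kappa_pow_of_lt_numStages {k l : ℕ} (hk : 0 < Real.log k) (hl : l < numStages k) :
    1 / Real.log k ^ 10 ≤ kappa ^ l := by
  have hκ := kappa_pos
  have h1 : (1 / kappa) ^ l ≤ Real.log k ^ 10 := by
    rw [← one_div_kappa_rpow hk, ← Real.rpow_natCast]
    exact Real.rpow_le_rpow_of_exponent_le (by norm_num [kappa]) (Nat.lt_ceil.1 hl).le
  rw [one_div_pow] at h1
  rw [one_div_le (by positivity) (by positivity)]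
  exact h1

theorem kappa_pow_mul_le {l j : ℕ} {c : ℝ} (h : c ≤ kappa ^ (l + j)) :
    c * (1 + j * 0.1) ≤ kappa ^ l := by
  have hκ := kappa_pos
  have h1 : 1 + (j : ℝ) * 0.1 ≤ (1 / kappa) ^ j :=
    (one_add_mul_le_pow (by norm_num) j).trans
      (pow_le_pow_left₀ (by norm_num) (by norm_num [kappa]) j)
  calc c * (1 + j * 0.1) ≤ kappa ^ (l + j) * (1 / kappa) ^ j := by gcongr
    _ = kappa ^ l := by
      rw [pow_add, mul_assoc, ← mul_pow, mul_one_div_cancel hκ.ne', one_pow, mul_one]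

/-- `M ≥ 50` makes the ratio of consecutive terms at most `exp (-1) ≤ 1 / 2`, and lets `exp (-0.1 M)
≤ exp (-5)` absorb the remaining factor 8. -/
theorem sum_exp_le {M : ℝ} (hM : 50 ≤ M) (L : ℕ) :
    ∑ j ∈ Finset.range L, 4 * Real.exp (-(0.2 * (M * (1 + j * 0.1)))) ≤ Real.exp (-(0.1 * M)) := by
  have h1 : Real.exp (-(0.02 * M)) ≤ 1 / 2 := by
    have h2 : Real.exp (-(0.02 * M)) ≤ Real.exp (-1) := Real.exp_le_exp.2 (by norm_num; linarith)
    have h3 : Real.exp (-1) ≤ 1 / 2 := by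
      rw [Real.exp_neg]
      refine inv_le_of_inv_le₀ (by norm_num) ?_
      linarith [Real.exp_one_gt_d9]
    exact h2.trans h3
  have h4 : ∀ j : ℕ, 4 * Real.exp (-(0.2 * (M * (1 + j * 0.1)))) ≤
      4 * Real.exp (-(0.2 * M)) * (1 / 2) ^ j := by
    intro j
    have : Real.exp (-(0.2 * (M * (1 + j * 0.1)))) =
        Real.exp (-(0.2 * M)) * Real.exp (-(0.02 * M)) ^ j := by
      rw [← Real.exp_nat_mul, ← Real.exp_add]
      congr 1
      ring
    rw [this, mul_assoc]
    gcongr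
  refine (Finset.sum_le_sum fun j _ => h4 j).trans ?_
  rw [← Finset.mul_sum]
  have h5 : ∑ j ∈ Finset.range L, (1 / 2 : ℝ) ^ j ≤ 2 := sum_geometric_two_le L
  have h6 : Real.exp (-(0.2 * M)) = Real.exp (-(0.1 * M)) * Real.exp (-(0.1 * M)) := by
    rw [← Real.exp_add]
    congr 1
    ring
  have h7 : Real.exp (-(0.1 * M)) ≤ 0.007 :=
    (Real.exp_le_exp.2 (by norm_num; linarith)).trans exp_neg_five_le
  have h8 := Real.exp_pos (-(0.1 * M))
  have h9 := Real.exp_pos (-(0.2 * M))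
  calc 4 * Real.exp (-(0.2 * M)) * ∑ j ∈ Finset.range L, (1 / 2 : ℝ) ^ j
      ≤ 4 * Real.exp (-(0.2 * M)) * 2 := by gcongr
    _ = 8 * Real.exp (-(0.1 * M)) * Real.exp (-(0.1 * M)) := by rw [h6]; ring
    _ ≤ 8 * 0.007 * Real.exp (-(0.1 * M)) := by gcongr
    _ ≤ Real.exp (-(0.1 * M)) := by norm_num at *; linarith

theorem sum_stage_failure_le {k : ℕ} (hk : 0 < Real.log k)
    (hM : 50 ≤ k / Real.log k ^ 10) :
    ∑ l ∈ Finset.range (numStages k), 4 * eexp (-(0.2 * (kappa ^ l * k))) ≤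
      ENNReal.ofReal ((2 : ℝ) ^ (-(0.1 * (k / Real.log k ^ 10)))) := by
  set M := (k : ℝ) / Real.log k ^ 10 with hMdef
  have h4 : ∀ x, 4 * eexp x = ENNReal.ofReal (4 * Real.exp x) := fun x => by
    rw [eexp, ENNReal.ofReal_mul (by norm_num)]
    norm_num
  simp only [h4]
  rw [← ENNReal.ofReal_sum_of_nonneg fun _ _ => by positivity]
  refine ENNReal.ofReal_le_ofReal ?_
  -- Counted back from the last stage, `κ^l k` starts at `M` or more and, by Bernoulli's inequality,
  -- grows at least linearly.
  rw [← Finset.sum_range_reflect]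
  have h1 : ∀ j ∈ Finset.range (numStages k),
      4 * Real.exp (-(0.2 * (kappa ^ (numStages k - 1 - j) * k))) ≤
        4 * Real.exp (-(0.2 * (M * (1 + j * 0.1)))) := by
    intro j hj
    rw [Finset.mem_range] at hj
    have h2 : 1 / Real.log k ^ 10 ≤ kappa ^ (numStages k - 1 - j + j) :=
      le_kappa_pow_of_lt_numStages hk (by omega)
    have h3 := kappa_pow_mul_le h2
    have h5 : M * (1 + j * 0.1) = 1 / Real.log k ^ 10 * (1 + j * 0.1) * k := by
      rw [hMdef]
      ring
    rw [h5]
    gcongr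
  refine (Finset.sum_le_sum h1).trans ((sum_exp_le hM _).trans ?_)
  rw [Real.rpow_def_of_pos (by norm_num)]
  refine Real.exp_le_exp.2 ?_
  have := Real.log_two_lt_d9
  nlinarith

/-- The width of the stage `j + 1` relative to the error bound, up to an absolute factor. -/
def relWidth (j : ℕ) : ℝ :=
  Real.log (500 / kappa ^ (j + 1)) * Real.sqrt ((j + 1 : ℕ) * lam ^ (j + 1))

theorem relWidth_nonneg (j : ℕ) : 0 ≤ relWidth j :=
  mul_nonneg (log_div_kappa_pow_pos _).le (Real.sqrt_nonneg _)

/-- The logarithm grows linearly in `j`, while the square root decays like `√λ ^ j` up to a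
polynomial factor. -/
theorem summable_relWidth : Summable relWidth := by
  have hκ := kappa_pos
  have hlam := lam_pos
  have hs1 : Real.sqrt lam < 1 := by
    rw [Real.sqrt_lt' one_pos]
    norm_num [lam]
  have hgeo : Summable fun n : ℕ => (n : ℝ) ^ 2 * Real.sqrt lam ^ n :=
    summable_pow_mul_geometric_of_norm_lt_one 2 (by
      rwa [Real.norm_of_nonneg (Real.sqrt_nonneg _)])
  have hgeo' := ((summable_nat_add_iff 1).2 hgeo).mul_left 501
  refine Summable.of_nonneg_of_le relWidth_nonneg (fun j => ?_) hgeo'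
  have hj : (1 : ℝ) ≤ (j + 1 : ℕ) := by
    push_cast
    linarith [(Nat.cast_nonneg j : (0 : ℝ) ≤ j)]
  have h1 : Real.log (500 / kappa ^ (j + 1)) ≤ 501 * (j + 1 : ℕ) := by
    rw [Real.log_div (by norm_num) (by positivity), Real.log_pow]
    have h2 : Real.log 500 ≤ 500 - 1 := Real.log_le_sub_one_of_pos (by norm_num)
    have h3 : -Real.log kappa ≤ 1 := by
      rw [← Real.log_inv]
      refine (Real.log_le_sub_one_of_pos (by positivity)).trans ?_
      norm_num [kappa]
    nlinarith
  have h4 : Real.sqrt ((j + 1 : ℕ) * lam ^ (j + 1)) ≤ (j + 1 : ℕ) * Real.sqrt lam ^ (j + 1) := by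
    refine Real.sqrt_le_iff.2 ⟨by positivity, ?_⟩
    rw [mul_pow, ← pow_mul, mul_comm (j + 1) 2, pow_mul, Real.sq_sqrt hlam.le]
    gcongr
    nlinarith
  calc relWidth j ≤ (501 * (j + 1 : ℕ)) * ((j + 1 : ℕ) * Real.sqrt lam ^ (j + 1)) := by
        unfold relWidth
        gcongr
    _ = _ := by ring

theorem width_succ_eq {k : ℕ} (hk : 0 < k) {ε δ : ℝ} (hε : 0 < ε) (hδ : 0 < δ) (hδ' : δ ≤ 0.5)
    (j : ℕ) : width k ε δ (j + 1) = 10 ^ 5 * errBound k ε δ * relWidth j := by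
  have hlog : 0 < Real.log (1 / δ) := by linarith [log_one_div_pos hδ hδ']
  have hs := Real.sqrt_pos.2 hlog
  have hsk : 0 < Real.sqrt k := Real.sqrt_pos.2 (by positivity)
  have hlam := lam_pos
  have hsj : 0 < Real.sqrt ((j + 1 : ℕ) * lam ^ (j + 1)) := Real.sqrt_pos.2 (by positivity)
  rw [width_eq hk, epsStage, epsZero, errBound, relWidth, Real.sqrt_mul (Nat.cast_nonneg k)]
  set S := Real.sqrt (Real.log (1 / δ))
  set J := Real.sqrt ((j + 1 : ℕ) * lam ^ (j + 1))
  field_simp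
  ring

theorem radius_le_errBound {k : ℕ} (hk : 0 < k) {ε δ : ℝ} (hε : 0 < ε) (hδ : 0 < δ)
    (hδ' : δ ≤ 0.5) (l : ℕ) :
    radius k ε δ l ≤ 6 * 10 ^ 5 * (∑' j, relWidth j) * errBound k ε δ := by
  have herr : 0 ≤ errBound k ε δ := by
    unfold errBound
    positivity
  have h1 : radius k ε δ l ≤ 6 * ∑ j ∈ Finset.range (l + 1), width k ε δ (j + 1) := by
    have h2 : ∑ j ∈ Finset.Ico 1 (l + 1), width k ε δ j =
        ∑ j ∈ Finset.range l, width k ε δ (j + 1) := by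
      rw [Finset.sum_Ico_eq_sum_range]
      simp [add_comm]
    have h3 : 0 ≤ ∑ j ∈ Finset.range l, width k ε δ (j + 1) :=
      Finset.sum_nonneg fun j _ => (width_pos hk hε hδ hδ' j.succ_pos).le
    have h4 := width_pos hk hε hδ hδ' l.succ_pos
    rw [radius, h2, Finset.sum_range_succ]
    simp only [Nat.succ_eq_add_one] at h4
    linarith
  refine h1.trans ?_
  simp only [width_succ_eq hk hε hδ hδ', ← Finset.mul_sum]
  have h5 := summable_relWidth.sum_le_tsum (Finset.range (l + 1)) fun j _ => relWidth_nonneg j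
  calc _ ≤ 6 * (10 ^ 5 * errBound k ε δ * ∑' j, relWidth j) := by gcongr
    _ = _ := by ring

theorem exists_le_div_log_pow :
    ∃ k₀ : ℕ, ∀ k : ℕ, k₀ ≤ k → 2 ≤ k → (50 : ℝ) ≤ k / Real.log k ^ 10 := by
  have h := (Real.isLittleO_pow_log_id_atTop (n := 10)).def (c := 1 / 50) (by norm_num)
  obtain ⟨k₀, hk₀⟩ := Filter.eventually_atTop.1 (tendsto_natCast_atTop_atTop.eventually h)
  refine ⟨k₀, fun k hk hk2 => ?_⟩
  have hlog : 0 < Real.log k := Real.log_pos (by exact_mod_cast hk2)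
  have h1 := hk₀ k hk
  rw [Real.norm_of_nonneg (by positivity), id, Real.norm_of_nonneg (by positivity)] at h1
  rw [le_div_iff₀ (by positivity)]
  linarith

theorem algorithm_utility {D : Type*} {k : ℕ} (hk : 0 < k) (hlog : 0 < Real.log k) {ε δ : ℝ}
    (hε : 0 < ε) (hδ : 0 < δ) (hδ' : δ ≤ 0.5) (hM : 50 ≤ k / Real.log k ^ 10)
    (q : Fin k → D → ℝ) (X : D) {b c : ℝ} (hb : ∀ l, radius k ε δ l ≤ b)
    (hc : k / Real.log k ^ 10 ≤ c) :
    ENNReal.ofReal (1 - (2 : ℝ) ^ (-(0.1 * (k / Real.log k ^ 10)))) ≤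
      algorithm ε δ q X {a | (largeCount (fun i => q i X) b a : ℝ) ≤ c} := by
  set v : Fin k → ℝ := fun i => q i X
  have hP : IsProbabilityMeasure (algorithm ε δ q X) := isProbabilityMeasure_iterativeSV v
    (fun l => epsStage_pos hk hε hδ hδ' l.succ_pos) (mCount k) (threshold k ε δ) (numStages k)
  have hS : MeasurableSet {a | (largeCount v b a : ℝ) ≤ c} :=
    measurableSet_le (measurable_from_top.comp (measurable_largeCount v b)) measurable_const
  have hbad : algorithm ε δ q X {a | (largeCount v b a : ℝ) ≤ c}ᶜ ≤
      ENNReal.ofReal ((2 : ℝ) ^ (-(0.1 * (k / Real.log k ^ 10)))) := by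
    refine (measure_mono ?_).trans ((iterativeSV_failure_le hk hε hδ hδ' v (numStages k)).trans
      (sum_stage_failure_le hlog hM))
    intro a ha
    have ha : c < largeCount v b a := not_le.1 ha
    have h1 : (largeCount v b a : ℝ) ≤ largeCount v (radius k ε δ (numStages k)) a := by
      exact_mod_cast largeCount_anti v (hb _) a
    have h2 : kappa ^ numStages k * k ≤ k / Real.log k ^ 10 := by
      rw [← one_div_mul_eq_div]
      gcongr
      exact kappa_pow_numStages_le hlog
    show kappa ^ numStages k * (k : ℝ) < _
    linarith
  rw [← compl_compl {a | (largeCount v b a : ℝ) ≤ c}, prob_compl_eq_one_sub hS.compl,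
    ENNReal.ofReal_sub _ (by positivity), ENNReal.ofReal_one]
  exact tsub_le_tsub_left hbad 1

end ISV

end

theorem mainTheorem3 :
    ∃ C₁ C₂ c : ℝ, 0 < C₁ ∧ 0 < C₂ ∧ 0 < c ∧
      ∀ (D : Type*) (Nbr : D → D → Prop) (k : ℕ) (ε δ : ℝ),
        0 < ε → ε ≤ 1 → 0 < δ → δ ≤ 0.5 →
        ∀ q : Fin k → D → ℝ, (∀ i, ISV.SensitivityLeOne Nbr (q i)) →
          ISV.IsDP Nbr ε δ (ISV.algorithm ε δ q) ∧
          (2 ≤ k → ∀ X : D,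
            ENNReal.ofReal (1 - (2 : ℝ) ^ (-(c * (k / Real.log k ^ 10)))) ≤
              ISV.algorithm ε δ q X
                {a | (({i : Fin k | ((C₁ * ISV.errBound k ε δ : ℝ) : WithTop ℝ) <
                    ISV.absErr (q i X) (a i)}.ncard : ℕ) : ℝ) ≤
                  C₂ * (k / Real.log k ^ 10)}) := by
  obtain ⟨k₀, hk₀⟩ := ISV.exists_le_div_log_pow
  have hW : 0 ≤ ∑' j, ISV.relWidth j := tsum_nonneg ISV.relWidth_nonneg
  -- The `+ 1` only secures positivity. In the second constant, the 1 serves `k ≥ k₀`, and `log k₀ ^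
  -- 10` makes the bound at least `k`, hence trivial, for `k ≤ k₀`.
  refine ⟨6 * 10 ^ 5 * (∑' j, ISV.relWidth j) + 1, 1 + Real.log k₀ ^ 10, 0.1, by positivity,
    add_pos_of_pos_of_nonneg one_pos (Even.pow_nonneg (by decide) _), by norm_num, ?_⟩
  intro D Nbr k ε δ hε hε1 hδ hδ' q hq
  refine ⟨ISV.isDP_algorithm hε hε1 hδ hδ' hq, fun hk2 X => ?_⟩
  have hk : 0 < k := by omega
  have hlog : 0 < Real.log k := Real.log_pos (by exact_mod_cast hk2)
  have hk₀' : 0 ≤ Real.log k₀ ^ 10 := Even.pow_nonneg (by decide) _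
  have hM : 0 ≤ (k : ℝ) / Real.log k ^ 10 := by positivity
  set C₁ := 6 * 10 ^ 5 * (∑' j, ISV.relWidth j) + 1
  rcases le_total k₀ k with h | h
  · refine ISV.algorithm_utility hk hlog hε hδ hδ' (hk₀ k h hk2) q X (fun l => ?_) ?_
    · refine (ISV.radius_le_errBound hk hε hδ hδ' l).trans ?_
      have : 0 ≤ ISV.errBound k ε δ := by
        unfold ISV.errBound
        positivity
      exact mul_le_mul_of_nonneg_right (by linarith) this
    · nlinarith
  · have hP : IsProbabilityMeasure (ISV.algorithm ε δ q X) :=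
      ISV.isProbabilityMeasure_iterativeSV _
        (fun l => ISV.epsStage_pos hk hε hδ hδ' l.succ_pos) _ _ _
    have hlogle : Real.log k ^ 10 ≤ Real.log k₀ ^ 10 := by
      gcongr
    have huniv : {a : Fin k → WithTop ℝ | (({i : Fin k | ((C₁ * ISV.errBound k ε δ : ℝ) :
        WithTop ℝ) < ISV.absErr (q i X) (a i)}.ncard : ℕ) : ℝ) ≤
          (1 + Real.log k₀ ^ 10) * (k / Real.log k ^ 10)} = Set.univ := by
      refine Set.eq_univ_of_forall fun a => ?_
      have h1 : (ISV.largeCount (fun i => q i X) (C₁ * ISV.errBound k ε δ) a : ℝ) ≤ k := by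
        exact_mod_cast ISV.largeCount_le _ _ a
      refine le_trans h1 ?_
      calc (k : ℝ) = Real.log k ^ 10 * (k / Real.log k ^ 10) := by field_simp
        _ ≤ _ := by
          gcongr
          linarith
    rw [huniv, measure_univ]
    refine ENNReal.ofReal_le_one.2 ?_
    have : (0 : ℝ) ≤ (2 : ℝ) ^ (-(0.1 * ((k : ℝ) / Real.log k ^ 10))) := by positivity
    linarith
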